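/- Let $\mathcal P=\langle x_1,\dots,x_m\mid r_1,\dots,r_n\rangle$ be a finite presentation of a group $G$ of cohomological dimension $2$ (that is, the trivial $\mathbb Z[G]$-module $\mathbb Z$ has projective dimension $2$). Let $K=K(\mathcal P)$ be its presentation complex, $\tilde K$ the universal cover of $K$, and $C_*(\tilde K)$ its cellular chain complex of free left $\mathbb Z[G]$-modules, so that $C_2(\tilde K)=\mathbb Z[G]^n$. Let $Z_1(\tilde K)=\ker\big(C_1(\tilde K)\to C_0(\tilde K)\big)$, $H_2(\tilde K)=\ker\big(C_2(\tilde K)\to C_1(\tilde K)\big)$ and $H_2(K)=\ker\big(C_2(K)\to C_1(K)\big)\subseteq\mathbb Z^n$, and let $\Sigma_K\subseteq H_2(K)$ be the subgroup of spherical 2-cycles, that is, the image of $\pi_2(K)=H_2(\tilde K)$ in $H_2(K)$. Let $\beta_2(G)$ be the rank of the abelian group $H_2(G)=H_2(G,\mathbb Z)$. Suppose that in addition to $\mathcal P$ one is given an idempotent matrix $E\in M_n(\mathbb Z[G])$, each entry written as an explicit finite $\mathbb Z$-linear combination of words in the generators and their inverses, such that, as an endomorphism of $C_2(\tilde K)$,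 $E$ has image isomorphic to $Z_1(\tilde K)$ and kernel isomorphic to $H_2(\tilde K)$ as $\mathbb Z[G]$-modules. (For example, $E=h\circ\partial$, where $h$ is a section of $\partial:C_2(\tilde K)\to Z_1(\tilde K)$.) Then there are algorithms which, for every such input $(\mathcal P,E)$, halt and do the following: 1. compute $\Sigma_K$: output integer vectors that form a $\mathbb Z$-basis of $\Sigma_K\subseteq H_2(K)\subseteq\mathbb Z^n$; 2. compute $H_2(G)$: there is an epimorphism $H_2(K)\to H_2(G)$ with kernel $\Sigma_K$, and the algorithm outputs integer vectors in $H_2(K)\subseteq\mathbb Z^n$ whose images form a $\mathbb Z$-basis of $H_2(G)$; 3. compute the number $\beta_2(G)$; 4. decide whether or not $H_2(G)=0$. Moreover, for every finite presentation $\mathcal P$ of a group $G$ of cohomological dimension $2$: 5. $\Sigma_K$ is a direct summand of $H_2(K)$, and $H_2(G)$ is a torsion-free abelian group. -/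

import Mathlib

open CategoryTheory

/-- A finite presentation `⟨x₁, …, x_m | r₁, …, r_n⟩`. The relators are words in the letters
`x^{±1}`: `(x, true)` stands for `x` and `(x, false)` for `x⁻¹`. Words need not be reduced, and
relators may be repeated. -/
structure FinPresentation where
  /-- the number of generators -/
  m : ℕ
  /-- the number of relators -/
  n : ℕ
  /-- the relators -/
  rel : Fin n → List (Fin m × Bool)

namespace FinPresentation

variable (P : FinPresentation)

/-- Words in the generators and their inverses. -/
abbrev Word : Type := List (Fin P.m × Bool)

/-- The group `G` defined by the presentation. -/
abbrev Grp : Type := PresentedGroup (Set.range fun i => FreeGroup.mk (P.rel i))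

/-- The element of `G` represented by a word. -/
def wordValue (w : P.Word) : P.Grp := PresentedGroup.mk _ (FreeGroup.mk w)

/-- The integral group ring `ℤ[G]`. -/
abbrev ZG : Type := MonoidAlgebra ℤ P.Grp

/-- The augmentation `ε : ℤ[G] → ℤ`, sending every element of `G` to `1`. -/
noncomputable def aug : P.ZG →+* ℤ :=
  (MonoidAlgebra.lift ℤ ℤ P.Grp (1 : P.Grp →* ℤ)).toRingHom

/-! ### The presentation complex `K` and its universal cover `K̃`

`K` has one vertex, one oriented edge for each generator, and one 2-cell for each relator, attached
along the loop that spells the relator. Its universal cover `K̃` has vertex set `G`, an edge from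
`g` to `g x` for each `g ∈ G` and each generator `x`, and for each `g ∈ G` and each relator `r` a
2-cell attached along the closed edge path that starts at `g` and spells `r`. The group `G` acts on
the left, and the cellular chain groups of `K̃` are the free left `ℤ[G]`-modules `C₀ = ℤ[G]`,
`C₁ = ℤ[G]^m`, `C₂ = ℤ[G]^n`. The chain groups of `K` are `ℤ`, `ℤ^m`, `ℤ^n`. -/

/-- The cellular 1-chain of `K̃` that is traversed by the edge path starting at the vertex `g` and
spelling the word `w`. The edge from `g` to `g x` is the chain `g · e_x`. -/
noncomputable def pathChain : P.Grp → P.Word → (Fin P.m → P.ZG)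
  | _, [] => 0
  | g, (x, true) :: w =>
      Pi.single x (MonoidAlgebra.of ℤ P.Grp g) + pathChain (g * PresentedGroup.of x) w
  | g, (x, false) :: w =>
      -Pi.single x (MonoidAlgebra.of ℤ P.Grp (g * (PresentedGroup.of x)⁻¹))
        + pathChain (g * (PresentedGroup.of x)⁻¹) w

/-- The boundary `C₁(K̃) → C₀(K̃)`: the edge from `1` to `x` has boundary `x - 1`. -/
noncomputable def d1 : (Fin P.m → P.ZG) →ₗ[P.ZG] P.ZG :=
  Fintype.linearCombination P.ZG fun x => MonoidAlgebra.of ℤ P.Grp (PresentedGroup.of x) - 1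

/-- The boundary `C₂(K̃) → C₁(K̃)`: the 2-cell at `1` of the relator `r` has as boundary the chain
of the closed path that starts at `1` and spells `r`. -/
noncomputable def d2 : (Fin P.n → P.ZG) →ₗ[P.ZG] (Fin P.m → P.ZG) :=
  Fintype.linearCombination P.ZG fun i => P.pathChain 1 (P.rel i)

/-- The 1-cycles `Z₁(K̃)`, a left `ℤ[G]`-module (the relation module). -/
noncomputable abbrev Z1cover : Submodule P.ZG (Fin P.m → P.ZG) := LinearMap.ker P.d1

/-- `H₂(K̃)`: as there are no 3-cells, this is the module of 2-cycles of `K̃`. -/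
noncomputable abbrev H2cover : Submodule P.ZG (Fin P.n → P.ZG) := LinearMap.ker P.d2

/-- The cellular 1-chain of `K` that is traversed by a word: the vector of exponent sums. -/
def expSum : P.Word → (Fin P.m → ℤ)
  | [] => 0
  | (x, true) :: w => Pi.single x 1 + expSum w
  | (x, false) :: w => -Pi.single x 1 + expSum w

/-- The boundary `C₂(K) → C₁(K)`. -/
def dK2 : (Fin P.n → ℤ) →ₗ[ℤ] (Fin P.m → ℤ) :=
  Fintype.linearCombination ℤ fun i => P.expSum (P.rel i)

/-- `H₂(K) ⊆ C₂(K) = ℤ^n`: as there are no 3-cells, this is the group of 2-cycles of `K`. -/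
abbrev H2 : Submodule ℤ (Fin P.n → ℤ) := LinearMap.ker P.dK2

/-- The covering projection on chains, `ℤ[G]^k → ℤ^k`: the augmentation in each coordinate. -/
noncomputable def proj (k : ℕ) : (Fin k → P.ZG) →+ (Fin k → ℤ) :=
  P.aug.toAddMonoidHom.compLeft (Fin k)

theorem aug_of (g : P.Grp) : P.aug (MonoidAlgebra.of ℤ P.Grp g) = 1 := by
  simp [aug]

theorem proj_single (x : Fin P.m) (g : P.Grp) :
    P.proj P.m (Pi.single x (MonoidAlgebra.of ℤ P.Grp g)) = Pi.single x 1 := by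
  funext y
  change P.aug ((Pi.single x (MonoidAlgebra.of ℤ P.Grp g) : Fin P.m → P.ZG) y) = _
  rcases eq_or_ne y x with rfl | h
  · rw [Pi.single_eq_same, Pi.single_eq_same, aug_of]
  · rw [Pi.single_eq_of_ne h, Pi.single_eq_of_ne h, map_zero]

theorem proj_pathChain (w : P.Word) (g : P.Grp) :
    P.proj P.m (P.pathChain g w) = P.expSum w := by
  induction w generalizing g with
  | nil => simp [pathChain, expSum]
  | cons a w ih =>
    rcases a with ⟨x, _ | _⟩
    · rw [pathChain, expSum, map_add, map_neg, proj_single, ih]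
    · rw [pathChain, expSum, map_add, proj_single, ih]

/-- The covering projection is a chain map. -/
theorem dK2_proj (c : Fin P.n → P.ZG) : P.dK2 (P.proj P.n c) = P.proj P.m (P.d2 c) := by
  rw [dK2, d2, Fintype.linearCombination_apply, Fintype.linearCombination_apply, map_sum]
  refine Finset.sum_congr rfl fun i _ => ?_
  rw [← P.proj_pathChain (P.rel i) 1]
  funext x
  change P.aug (c i) * P.aug (P.pathChain 1 (P.rel i) x) =
    P.aug (c i * P.pathChain 1 (P.rel i) x)
  rw [map_mul]

/-- The map `H₂(K̃) → H₂(K)` induced by the covering projection. -/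
noncomputable def coverMap : P.H2cover →+ P.H2 :=
  ((P.proj P.n).comp P.H2cover.subtype.toAddMonoidHom).codRestrict P.H2 fun c => by
    have hc : P.d2 (c : Fin P.n → P.ZG) = 0 := c.2
    change P.dK2 (P.proj P.n (c : Fin P.n → P.ZG)) = 0
    rw [dK2_proj, hc, map_zero]

/-- The group `Σ_K ⊆ H₂(K)` of spherical 2-cycles: the image of `π₂(K) = π₂(K̃) = H₂(K̃)`
in `H₂(K)`. -/
noncomputable def sigma : Submodule ℤ P.H2 := AddSubgroup.toIntSubmodule P.coverMap.range

/-- The integral homology `H₂(G)` of the group `G`, with trivial coefficients `ℤ`. -/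
noncomputable abbrev groupH2 : ModuleCat ℤ := groupHomology (Rep.trivial ℤ P.Grp ℤ) 2

/-- `cd G = 2`: the trivial `ℤ[G]`-module `ℤ` has projective dimension `2`. -/
def HasCdTwo : Prop := projectiveDimension (Rep.trivial ℤ P.Grp ℤ) = 2

/-! ### Explicitly given elements and matrices over `ℤ[G]` -/

/-- An explicit element of `ℤ[G]`: a finite formal `ℤ`-linear combination of words. -/
abbrev FormalSum : Type := List (ℤ × P.Word)

/-- The element of `ℤ[G]` represented by a formal linear combination of words. -/
noncomputable def formalSumValue (s : P.FormalSum) : P.ZG :=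
  (s.map fun t => t.1 • MonoidAlgebra.of ℤ P.Grp (P.wordValue t.2)).sum

/-- An explicit `n × n` matrix over `ℤ[G]`. -/
abbrev FormalMatrix : Type := Fin P.n → Fin P.n → P.FormalSum

/-- The matrix over `ℤ[G]` represented by an explicit one. -/
noncomputable def matrixValue (M : P.FormalMatrix) : Matrix (Fin P.n) (Fin P.n) P.ZG :=
  Matrix.of fun i j => P.formalSumValue (M i j)

/-- The input data: `G` has cohomological dimension 2 and `M` represents an idempotent matrix
`E` over `ℤ[G]` which, as an endomorphism `c ↦ c E` of the left module `C₂(K̃) = ℤ[G]^n` of row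
vectors, has image isomorphic to `Z₁(K̃)` and kernel isomorphic to `H₂(K̃)`. -/
structure Admissible (M : P.FormalMatrix) : Prop where
  cd_two : P.HasCdTwo
  idempotent : P.matrixValue M * P.matrixValue M = P.matrixValue M
  image_iso : Nonempty (LinearMap.range (P.matrixValue M).vecMulLinear ≃ₗ[P.ZG] P.Z1cover)
  kernel_iso : Nonempty (LinearMap.ker (P.matrixValue M).vecMulLinear ≃ₗ[P.ZG] P.H2cover)

/-! ### Inputs and outputs of algorithms -/

/-- The type of inputs: the number of generators, the list of relators, and the list of the rows of
a matrix of formal linear combinations of words; a generator is given by its index. -/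
abbrev Input : Type :=
  (ℕ × List (List (ℕ × Bool))) × List (List (List (ℤ × List (ℕ × Bool))))

/-- A word, with the generators replaced by their indices. -/
def codeWord (w : P.Word) : List (ℕ × Bool) := w.map fun a => ((a.1 : ℕ), a.2)

/-- The input that consists of the presentation `P` and the explicit matrix `M`. -/
def code (M : P.FormalMatrix) : Input :=
  ((P.m, List.ofFn fun i => P.codeWord (P.rel i)),
    List.ofFn fun i => List.ofFn fun j => (M i j).map fun t => (t.1, P.codeWord t.2))

/-- A finite family of elements of `H₂(K) ⊆ ℤ^n`, written as a list of integer vectors. -/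
def codeCycles {k : ℕ} (v : Fin k → P.H2) : List (List ℤ) :=
  List.ofFn fun i => List.ofFn (v i : Fin P.n → ℤ)

end FinPresentation

/-! The first homology of the universal cover vanishes, so `d2` maps `C₂(K̃)` onto `Z₁(K̃)`. Since
`cd G = 2`, dimension shifting makes `Z₁(K̃)` projective; a section `s` then splits off `H₂(K̃)` in
`C₂(K̃)`, and augmenting the projection `1 - s ∘ d2` gives a projection of `ℤⁿ` onto `Σ_K`
(`exists_projection_sphericalModule`). Hence `Σ_K` is a direct summand of `H₂(K)`. Hopf's formula
`H₂(G) ≅ H₂(K)/Σ_K` (`hopf_surjective`, `ker_hopf`), proved by comparing cellular chains with the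
bar complex, then shows that `H₂(G)` is torsion-free.

The matrix `E` enters only through the rank of `Σ_K`. The isomorphisms of kernels and images
assemble to an automorphism of `C₂(K̃)` that carries `ker E` onto `H₂(K̃)`. After augmentation,
`Σ_K` becomes isomorphic to the image of the idempotent `1 - ε(E)`, whose rank is its trace `n - ∑
ε(E i i)` (`finrank_sphericalModule`). This number is read off from the coefficients of the diagonal
entries, without solving the word problem in `G`.

Spherical cycles can be enumerated: they are the vectors of signed relator counts of identity
sequences, that is, of products of conjugates of relators that are trivial in the free group
(`signCount_mem_sphericalModule`, `exists_identity_seq`). If as many such cycles as the rank of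
`Σ_K` are part of a family with a left inverse over `ℤ`, they already span `Σ_K` (`span_eq_sigma`).
A certificate consists of identity sequences for a basis of `Σ_K`, an extension to a basis of
`H₂(K)`, and matrices that witness the basis property. Validity is primitive recursive, a valid
certificate exists for every admissible input, and so an unbounded search halts. All four outputs
are read off from the certificate found. -/

namespace FinPresentation

variable (P : FinPresentation)

/-! ### Chains of the universal cover -/

variable {P} in
/-- The additive map `ℤ[G] → M` with prescribed values on `G`. -/
noncomputable def zgLift {M : Type*} [AddCommGroup M] (f : P.Grp → M) : P.ZG →+ M :=
  (Finsupp.liftAddHom fun g => zmultiplesHom M (f g)).comp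
    MonoidAlgebra.coeffAddEquiv.toAddMonoidHom

variable {P} in
@[simp] theorem zgLift_of {M : Type*} [AddCommGroup M] (f : P.Grp → M) (g : P.Grp) :
    zgLift f (MonoidAlgebra.of ℤ P.Grp g) = f g := by
  change Finsupp.liftAddHom (fun g => zmultiplesHom M (f g)) (Finsupp.single g 1) = f g
  simp

variable {P} in
theorem zg_hom_ext {M : Type*} [AddCommGroup M] {f f' : P.ZG →+ M}
    (h : ∀ g, f (MonoidAlgebra.of ℤ P.Grp g) = f' (MonoidAlgebra.of ℤ P.Grp g)) : f = f' := by
  refine MonoidAlgebra.addHom_ext' fun g => ?_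
  ext
  simpa using h g

variable {P} in
/-- The cell `g · e_x`. -/
noncomputable def cell {k : ℕ} (g : P.Grp) (x : Fin k) : Fin k → P.ZG :=
  Pi.single x (MonoidAlgebra.of ℤ P.Grp g)

variable {P} in
/-- The additive map on cellular chains with prescribed values on cells. -/
noncomputable def chainLift {k : ℕ} {M : Type*} [AddCommGroup M] (f : P.Grp → Fin k → M) :
    (Fin k → P.ZG) →+ M :=
  ∑ x, (zgLift fun g => f g x).comp (Pi.evalAddMonoidHom _ x)

variable {P} in
@[simp] theorem chainLift_cell {k : ℕ} {M : Type*} [AddCommGroup M] (f : P.Grp → Fin k → M)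
    (g : P.Grp) (x : Fin k) : chainLift f (cell g x) = f g x := by
  rw [chainLift, AddMonoidHom.finsetSum_apply, Finset.sum_eq_single x]
  · simp [cell, -MonoidAlgebra.of_apply]
  · intro y _ hy
    simp [cell, Pi.single_eq_of_ne hy]
  · simp

variable {P} in
theorem chain_hom_ext {k : ℕ} {M : Type*} [AddCommGroup M] {f f' : (Fin k → P.ZG) →+ M}
    (h : ∀ g x, f (cell g x) = f' (cell g x)) : f = f' := by
  refine AddMonoidHom.functions_ext' _ _ _ fun x => ?_
  exact zg_hom_ext fun g => h g x

theorem of_smul_cell {k : ℕ} (g h : P.Grp) (x : Fin k) :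
    MonoidAlgebra.of ℤ P.Grp g • cell h x = cell (g * h) x := by
  rw [cell, cell, ← Pi.single_smul', smul_eq_mul, map_mul]

@[simp] theorem d1_cell (g : P.Grp) (x : Fin P.m) :
    P.d1 (cell g x) =
      MonoidAlgebra.of ℤ P.Grp (g * PresentedGroup.of x) - MonoidAlgebra.of ℤ P.Grp g := by
  rw [d1, cell, Fintype.linearCombination_apply_single, smul_eq_mul, mul_sub, mul_one, map_mul]

theorem d2_cell (g : P.Grp) (i : Fin P.n) :
    P.d2 (cell g i) = MonoidAlgebra.of ℤ P.Grp g • P.pathChain 1 (P.rel i) := by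
  rw [d2, cell, Fintype.linearCombination_apply_single]

/-! ### Edge paths, and exactness of the cellular complex at `C₁(K̃)` -/

@[simp] theorem wordValue_nil : P.wordValue [] = 1 := rfl

theorem wordValue_append (u v : P.Word) :
    P.wordValue (u ++ v) = P.wordValue u * P.wordValue v := by
  simp [wordValue, ← FreeGroup.mul_mk]

theorem wordValue_true (x : Fin P.m) : P.wordValue [(x, true)] = PresentedGroup.of x := rfl

theorem wordValue_false (x : Fin P.m) :
    P.wordValue [(x, false)] = (PresentedGroup.of x)⁻¹ := rfl

theorem wordValue_cons_true (x : Fin P.m) (w : P.Word) :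
    P.wordValue ((x, true) :: w) = PresentedGroup.of x * P.wordValue w :=
  P.wordValue_append [(x, true)] w

theorem wordValue_cons_false (x : Fin P.m) (w : P.Word) :
    P.wordValue ((x, false) :: w) = (PresentedGroup.of x)⁻¹ * P.wordValue w :=
  P.wordValue_append [(x, false)] w

theorem wordValue_surjective : Function.Surjective P.wordValue := by
  intro g
  obtain ⟨w, rfl⟩ := PresentedGroup.mk_surjective _ g
  exact ⟨w.toWord, by rw [wordValue, FreeGroup.mk_toWord]⟩

@[simp] theorem wordValue_rel (i : Fin P.n) : P.wordValue (P.rel i) = 1 :=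
  PresentedGroup.one_of_mem ⟨i, rfl⟩

theorem pathChain_append (g : P.Grp) (u v : P.Word) :
    P.pathChain g (u ++ v) = P.pathChain g u + P.pathChain (g * P.wordValue u) v := by
  induction u generalizing g with
  | nil => simp [pathChain]
  | cons a u ih =>
    rcases a with ⟨x, _ | _⟩
    · rw [List.cons_append, pathChain, pathChain, ih, wordValue_cons_false, mul_assoc, add_assoc]
    · rw [List.cons_append, pathChain, pathChain, ih, wordValue_cons_true, mul_assoc, add_assoc]

theorem of_smul_pathChain (g h : P.Grp) (w : P.Word) :
    MonoidAlgebra.of ℤ P.Grp g • P.pathChain h w = P.pathChain (g * h) w := by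
  induction w generalizing h with
  | nil => simp [pathChain]
  | cons a w ih =>
    rcases a with ⟨x, _ | _⟩
    · have := P.of_smul_cell g (h * (PresentedGroup.of x)⁻¹) x
      rw [pathChain, pathChain, smul_add, ih, smul_neg, ← cell, this, mul_assoc, cell]
    · rw [pathChain, pathChain, smul_add, ih, ← cell, of_smul_cell, mul_assoc, cell]

theorem d1_pathChain (g : P.Grp) (w : P.Word) :
    P.d1 (P.pathChain g w) =
      MonoidAlgebra.of ℤ P.Grp (g * P.wordValue w) - MonoidAlgebra.of ℤ P.Grp g := by
  induction w generalizing g with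
  | nil => simp [pathChain]
  | cons a w ih =>
    rcases a with ⟨x, _ | _⟩
    · rw [pathChain, map_add, ih, map_neg, ← cell, d1_cell, wordValue_cons_false, inv_mul_cancel_right,
        mul_assoc]
      abel
    · rw [pathChain, map_add, ih, ← cell, d1_cell, wordValue_cons_true, mul_assoc]
      abel

theorem d1_comp_d2 : P.d1 ∘ₗ P.d2 = 0 := by
  have : (P.d1 ∘ₗ P.d2).toAddMonoidHom = 0 := chain_hom_ext fun g i => by
    change P.d1 (P.d2 (cell g i)) = 0
    rw [d2_cell, map_smul, d1_pathChain]
    simp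
  exact LinearMap.toAddMonoidHom_injective this

theorem range_d2_le : LinearMap.range P.d2 ≤ LinearMap.ker P.d1 :=
  LinearMap.range_le_ker_iff.2 P.d1_comp_d2

theorem pathChain_rel_mem (g : P.Grp) (i : Fin P.n) :
    P.pathChain g (P.rel i) ∈ LinearMap.range P.d2 :=
  ⟨cell g i, by rw [d2_cell, of_smul_pathChain, mul_one]⟩

/-- A generator moves along its edge, recording the chain it traverses modulo boundaries. -/
noncomputable def pathStep (x : Fin P.m) :
    Equiv.Perm (((Fin P.m → P.ZG) ⧸ LinearMap.range P.d2) × P.Grp) where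
  toFun p := (p.1 + Submodule.Quotient.mk (cell p.2 x), p.2 * PresentedGroup.of x)
  invFun p := (p.1 - Submodule.Quotient.mk (cell (p.2 * (PresentedGroup.of x)⁻¹) x),
    p.2 * (PresentedGroup.of x)⁻¹)
  left_inv p := by simp
  right_inv p := by simp

/-- The letters act in reading order, which is the reverse of composition of permutations; hence the
opposite group. -/
theorem lift_pathStep_mk (w : P.Word)
    (p : ((Fin P.m → P.ZG) ⧸ LinearMap.range P.d2) × P.Grp) :
    (FreeGroup.lift (fun x => MulOpposite.op (P.pathStep x)) (FreeGroup.mk w)).unop p =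
      (p.1 + Submodule.Quotient.mk (P.pathChain p.2 w), p.2 * P.wordValue w) := by
  induction w generalizing p with
  | nil =>
    rw [← FreeGroup.one_eq_mk, map_one]
    simp [pathChain]
  | cons a w ih =>
    have : FreeGroup.mk (a :: w) = FreeGroup.mk [a] * FreeGroup.mk w := by
      rw [FreeGroup.mul_mk]; rfl
    rw [this, map_mul, MulOpposite.unop_mul, Equiv.Perm.mul_apply, ih]
    rcases a with ⟨x, _ | _⟩
    · rw [pathChain, wordValue_cons_false]
      simp [pathStep, cell, sub_eq_add_neg, add_assoc, mul_assoc, Equiv.Perm.inv_def]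
    · rw [pathChain, wordValue_cons_true]
      simp [pathStep, cell, add_assoc, mul_assoc]

/-- Modulo boundaries, the chain of a path depends only on its end points. -/
theorem pathChain_sub_mem {u v : P.Word} (h : P.wordValue u = P.wordValue v) (g : P.Grp) :
    P.pathChain g u - P.pathChain g v ∈ LinearMap.range P.d2 := by
  -- Relators close up in `G` and trace boundaries, so they act trivially and the action descends to
  -- `G`. Words with the same value then move `(0, g)` to the same point.
  have hrel : ∀ r ∈ Set.range fun i => FreeGroup.mk (P.rel i),
      FreeGroup.lift (fun x => MulOpposite.op (P.pathStep x)) r = 1 := by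
    rintro _ ⟨i, rfl⟩
    refine MulOpposite.unop_injective (Equiv.ext fun p => ?_)
    rw [lift_pathStep_mk, wordValue_rel, mul_one,
      (Submodule.Quotient.mk_eq_zero _).2 (P.pathChain_rel_mem p.2 i), add_zero]
    rfl
  have key := congrArg (fun z => ((PresentedGroup.toGroup hrel z).unop (0, g)).1) h
  have e : ∀ w : P.Word, PresentedGroup.toGroup hrel (P.wordValue w) =
    FreeGroup.lift (fun x => MulOpposite.op (P.pathStep x)) (FreeGroup.mk w) := fun _ => rfl
  simp only [e, lift_pathStep_mk, zero_add] at key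
  exact (Submodule.Quotient.eq _).1 key

/-- A word representing a group element. -/
noncomputable def wordOf (g : P.Grp) : P.Word := (P.wordValue_surjective g).choose

@[simp] theorem wordValue_wordOf (g : P.Grp) : P.wordValue (P.wordOf g) = g :=
  (P.wordValue_surjective g).choose_spec

/-- The chain of a path from `1` to `g`. -/
noncomputable def pathTo (g : P.Grp) : Fin P.m → P.ZG := P.pathChain 1 (P.wordOf g)

theorem d1_pathTo (g : P.Grp) :
    P.d1 (P.pathTo g) = MonoidAlgebra.of ℤ P.Grp g - 1 := by
  rw [pathTo, d1_pathChain, one_mul, wordValue_wordOf, map_one]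

/-- The first homology of the universal cover vanishes. -/
theorem ker_d1_eq_range_d2 : LinearMap.ker P.d1 = LinearMap.range P.d2 := by
  refine le_antisymm (fun z hz => ?_) P.range_d2_le
  -- Modulo boundaries, an edge from `g` to `g x` is the chosen path to `g x` minus the chosen path
  -- to `g`. The class of a chain therefore depends only on its boundary, and that of a cycle is
  -- zero.
  have key : (zgLift fun g => (Submodule.Quotient.mk (P.pathTo g) :
      (Fin P.m → P.ZG) ⧸ LinearMap.range P.d2)).comp P.d1.toAddMonoidHom =
      (Submodule.mkQ (LinearMap.range P.d2)).toAddMonoidHom := chain_hom_ext fun g x => by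
    change zgLift _ (P.d1 (cell g x)) = Submodule.Quotient.mk (cell g x)
    rw [d1_cell, map_sub, zgLift_of, zgLift_of, ← Submodule.Quotient.mk_sub, Submodule.Quotient.eq]
    have h : P.wordValue (P.wordOf (g * PresentedGroup.of x)) =
        P.wordValue (P.wordOf g ++ [(x, true)]) := by
      rw [wordValue_append, wordValue_wordOf, wordValue_wordOf, wordValue_true]
    have := P.pathChain_sub_mem h 1
    rw [pathChain_append, one_mul, wordValue_wordOf, pathChain, pathChain, add_zero, ← cell,
      sub_add_eq_sub_sub] at this
    exact this
  have h0 := DFunLike.congr_fun key z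
  have hz' : P.d1 z = 0 := hz
  change zgLift _ (P.d1 z) = Submodule.Quotient.mk z at h0
  rw [hz', map_zero] at h0
  exact (Submodule.Quotient.mk_eq_zero _).1 h0.symm

/-! ### Augmentation of linear maps -/

@[simp] theorem proj_cell {k : ℕ} (g : P.Grp) (x : Fin k) :
    P.proj k (cell g x) = Pi.single x 1 := by
  funext y
  change P.aug ((Pi.single x (MonoidAlgebra.of ℤ P.Grp g) : Fin k → P.ZG) y) = _
  rcases eq_or_ne y x with rfl | h
  · rw [Pi.single_eq_same, Pi.single_eq_same, aug_of]
  · rw [Pi.single_eq_of_ne h, Pi.single_eq_of_ne h, map_zero]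

@[simp] theorem proj_apply {k : ℕ} (c : Fin k → P.ZG) (x : Fin k) : P.proj k c x = P.aug (c x) :=
  rfl

theorem proj_smul {k : ℕ} (a : P.ZG) (c : Fin k → P.ZG) :
    P.proj k (a • c) = P.aug a • P.proj k c := by
  funext x
  simp

theorem proj_surjective (k : ℕ) : Function.Surjective (P.proj k) := by
  intro v
  refine ⟨fun x => (v x : P.ZG), ?_⟩
  funext x
  simp

/-- The map of `ℤ`-modules obtained from a `ℤ[G]`-linear map by augmentation. -/
noncomputable def bar {k l : ℕ} (f : (Fin k → P.ZG) →ₗ[P.ZG] (Fin l → P.ZG)) :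
    (Fin k → ℤ) →ₗ[ℤ] (Fin l → ℤ) :=
  Fintype.linearCombination ℤ fun i => P.proj l (f (Pi.single i 1))

theorem bar_proj {k l : ℕ} (f : (Fin k → P.ZG) →ₗ[P.ZG] (Fin l → P.ZG)) (c : Fin k → P.ZG) :
    P.bar f (P.proj k c) = P.proj l (f c) := by
  conv_rhs => rw [pi_eq_sum_univ' c]
  rw [bar, Fintype.linearCombination_apply, map_sum, map_sum]
  refine Finset.sum_congr rfl fun i _ => ?_
  rw [map_smul, proj_smul, proj_apply]

theorem bar_comp {k l p : ℕ} (f : (Fin l → P.ZG) →ₗ[P.ZG] (Fin p → P.ZG))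
    (g : (Fin k → P.ZG) →ₗ[P.ZG] (Fin l → P.ZG)) : P.bar (f ∘ₗ g) = P.bar f ∘ₗ P.bar g := by
  refine LinearMap.ext fun v => ?_
  obtain ⟨c, rfl⟩ := P.proj_surjective k v
  rw [bar_proj, LinearMap.comp_apply, LinearMap.comp_apply, bar_proj, bar_proj]

theorem bar_id (k : ℕ) : P.bar (LinearMap.id : (Fin k → P.ZG) →ₗ[P.ZG] _) = LinearMap.id := by
  refine LinearMap.ext fun v => ?_
  obtain ⟨c, rfl⟩ := P.proj_surjective k v
  rw [bar_proj, LinearMap.id_apply, LinearMap.id_apply]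

end FinPresentation

namespace FinPresentation

variable (P : FinPresentation)

/-! ### Hopf's formula -/

/-- The additive map on a free abelian group with prescribed values on a basis. -/
noncomputable def basisLift {α M : Type*} [AddCommGroup M] (f : α → M) : (α →₀ ℤ) →+ M :=
  Finsupp.liftAddHom fun a => zmultiplesHom M (f a)

@[simp] theorem basisLift_single {α M : Type*} [AddCommGroup M] (f : α → M) (a : α) :
    basisLift f (Finsupp.single a 1) = f a := by
  simp [basisLift]

theorem basis_hom_ext {α M : Type*} [AddCommGroup M] {f f' : (α →₀ ℤ) →+ M}
    (h : ∀ a, f (Finsupp.single a 1) = f' (Finsupp.single a 1)) : f = f' := by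
  refine Finsupp.addHom_ext' fun a => ?_
  ext
  simpa using h a

/-- The trivial representation on `ℤ`. -/
noncomputable abbrev trivRep : Rep ℤ P.Grp := Rep.trivial ℤ P.Grp ℤ

/-- The inhomogeneous boundary `ℤ[G²] → ℤ[G]`. -/
noncomputable def barD : (P.Grp × P.Grp →₀ ℤ) →+ (P.Grp →₀ ℤ) :=
  (groupHomology.d₂₁ P.trivRep).hom.toAddMonoidHom

theorem barD_single (g h : P.Grp) :
    P.barD (Finsupp.single (g, h) 1) =
      Finsupp.single h 1 - Finsupp.single (g * h) 1 + Finsupp.single g 1 :=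
  groupHomology.d₂₁_single (A := P.trivRep) (g, h) (1 : ℤ)

/-- Boundaries among the inhomogeneous `2`-chains. -/
noncomputable def barB : Submodule ℤ (P.Grp × P.Grp →₀ ℤ) := groupHomology.boundaries₂ P.trivRep

theorem barB_relation (g h j : P.Grp) :
    (Finsupp.single (h, j) 1 - Finsupp.single (g * h, j) 1 + Finsupp.single (g, h * j) 1
      - Finsupp.single (g, h) 1 : P.Grp × P.Grp →₀ ℤ) ∈ P.barB :=
  ⟨Finsupp.single (g, h, j) (1 : ℤ), groupHomology.d₃₂_single (A := P.trivRep) (g, h, j) (1 : ℤ)⟩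

theorem barB_induction {M : Type*} [AddCommGroup M] (f : (P.Grp × P.Grp →₀ ℤ) →+ M)
    (hf : ∀ g h j, f (Finsupp.single (h, j) 1 - Finsupp.single (g * h, j) 1
      + Finsupp.single (g, h * j) 1 - Finsupp.single (g, h) 1) = 0)
    {z : P.Grp × P.Grp →₀ ℤ} (hz : z ∈ P.barB) : f z = 0 := by
  obtain ⟨y, rfl⟩ := hz
  have : f.comp (groupHomology.d₃₂ P.trivRep).hom.toAddMonoidHom = 0 :=
    basis_hom_ext fun ⟨g, h, j⟩ => by
      refine Eq.trans (congrArg f ?_) (hf g h j)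
      exact groupHomology.d₃₂_single (A := P.trivRep) (g, h, j) (1 : ℤ)
  exact DFunLike.congr_fun this y

/-- The comparison map `C₁(K̃) → ℤ[G²]`. -/
noncomputable def compare : (Fin P.m → P.ZG) →+ (P.Grp × P.Grp →₀ ℤ) :=
  chainLift fun g x => Finsupp.single (g, PresentedGroup.of x) 1

/-- The comparison map is not invariant under translation by `g`; the bar cells `[g|h|x]` measure
the defect as a term in the boundary of `c`. On cycles, invariance modulo boundaries follows. -/
theorem mk_compare_smul (g : P.Grp) (c : Fin P.m → P.ZG) :
    P.barB.mkQ (P.compare (MonoidAlgebra.of ℤ P.Grp g • c)) =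
      P.barB.mkQ (P.compare c) +
        zgLift (fun h => P.barB.mkQ (Finsupp.single (g, h) 1)) (P.d1 c) := by
  have : (P.barB.mkQ.toAddMonoidHom.comp P.compare).comp
        (DistribSMul.toAddMonoidHom (Fin P.m → P.ZG) (MonoidAlgebra.of ℤ P.Grp g)) =
      P.barB.mkQ.toAddMonoidHom.comp P.compare +
        (zgLift fun h => P.barB.mkQ (Finsupp.single (g, h) 1)).comp P.d1.toAddMonoidHom :=
    chain_hom_ext fun h x => by
      change P.barB.mkQ (P.compare (MonoidAlgebra.of ℤ P.Grp g • cell h x)) =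
        P.barB.mkQ (P.compare (cell h x)) + zgLift _ (P.d1 (cell h x))
      rw [of_smul_cell, compare, chainLift_cell, chainLift_cell, d1_cell, map_sub, zgLift_of,
        zgLift_of, ← map_sub, ← map_add, Submodule.mkQ_apply, Submodule.mkQ_apply, eq_comm,
        Submodule.Quotient.eq]
      convert P.barB_relation g h (PresentedGroup.of x) using 1
      abel
  exact DFunLike.congr_fun this c

/-- The map `ℤⁿ → ℤ[G²]` which induces the epimorphism `H₂(K) → H₂(G)`. -/
noncomputable def hopfChain : (Fin P.n → ℤ) →ₗ[ℤ] (P.Grp × P.Grp →₀ ℤ) :=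
  Fintype.linearCombination ℤ fun i => P.compare (P.d2 (cell 1 i))

/-- Boundaries of 2-cells are cycles, so their images in the bar complex modulo boundaries do not
change under translation. This allows the passage from `C₂(K̃)` to `ℤⁿ`. -/
theorem mk_hopfChain_proj (c : Fin P.n → P.ZG) :
    P.barB.mkQ (P.hopfChain (P.proj P.n c)) = P.barB.mkQ (P.compare (P.d2 c)) := by
  have : (P.barB.mkQ.toAddMonoidHom.comp P.hopfChain.toAddMonoidHom).comp (P.proj P.n) =
      (P.barB.mkQ.toAddMonoidHom.comp P.compare).comp P.d2.toAddMonoidHom :=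
    chain_hom_ext fun g i => by
      change P.barB.mkQ (P.hopfChain (P.proj P.n (cell g i))) =
        P.barB.mkQ (P.compare (P.d2 (cell g i)))
      have h0 : P.d1 (P.d2 (cell 1 i)) = 0 := LinearMap.congr_fun P.d1_comp_d2 _
      have h1 : (cell g i : Fin P.n → P.ZG) = MonoidAlgebra.of ℤ P.Grp g • cell 1 i := by
        rw [of_smul_cell, mul_one]
      rw [proj_cell, hopfChain, Fintype.linearCombination_apply_single, one_smul, h1, map_smul,
        mk_compare_smul, h0, map_zero, add_zero]
  exact DFunLike.congr_fun this c

/-- In the bar boundary `[x] - [g x] + [g]` of `[g|x]`, the last two terms form the negative of the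
cellular boundary of the edge, and only exponent sums remain on cycles. -/
theorem barD_compare (c : Fin P.m → P.ZG) (hc : P.d1 c = 0) :
    P.barD (P.compare c) = Fintype.linearCombination ℤ
      (fun x => (Finsupp.single (PresentedGroup.of x) 1 : P.Grp →₀ ℤ)) (P.proj P.m c) := by
  have : P.barD.comp P.compare =
      (Fintype.linearCombination ℤ
        (fun x => (Finsupp.single (PresentedGroup.of x) 1 : P.Grp →₀ ℤ))).toAddMonoidHom.comp
        (P.proj P.m) -
      (zgLift fun g => (Finsupp.single g 1 : P.Grp →₀ ℤ)).comp P.d1.toAddMonoidHom :=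
    chain_hom_ext fun g x => by
      change P.barD (P.compare (cell g x)) = Fintype.linearCombination ℤ _ (P.proj P.m (cell g x)) -
        zgLift _ (P.d1 (cell g x))
      rw [compare, chainLift_cell, barD_single, proj_cell, Fintype.linearCombination_apply_single,
        one_smul, d1_cell, map_sub, zgLift_of, zgLift_of]
      abel
  have h := DFunLike.congr_fun this c
  change P.barD (P.compare c) = Fintype.linearCombination ℤ _ (P.proj P.m c) - zgLift _ (P.d1 c) at h
  rw [h, hc, map_zero, sub_zero]

theorem barD_hopfChain (v : Fin P.n → ℤ) (hv : P.dK2 v = 0) : P.barD (P.hopfChain v) = 0 := by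
  have key : P.barD.comp P.hopfChain.toAddMonoidHom =
      ((Fintype.linearCombination ℤ
        (fun x => (Finsupp.single (PresentedGroup.of x) 1 : P.Grp →₀ ℤ))).comp
        P.dK2).toAddMonoidHom := by
    refine AddMonoidHom.functions_ext' _ _ _ fun i => ?_
    ext1
    change P.barD (P.hopfChain (Pi.single i 1)) =
      Fintype.linearCombination ℤ _ (P.dK2 (Pi.single i 1))
    rw [hopfChain, Fintype.linearCombination_apply_single, one_smul,
      barD_compare _ _ (LinearMap.congr_fun P.d1_comp_d2 _), ← dK2_proj, proj_cell]
  have h := DFunLike.congr_fun key v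
  change P.barD (P.hopfChain v) = Fintype.linearCombination ℤ _ (P.dK2 v) at h
  rw [h, hv, map_zero]

/-- The spherical cycles, as a subgroup of `ℤⁿ`. -/
noncomputable def spherical : AddSubgroup (Fin P.n → ℤ) :=
  P.H2cover.toAddSubgroup.map (P.proj P.n)

theorem mem_sigma_iff {v : P.H2} : v ∈ P.sigma ↔ (v : Fin P.n → ℤ) ∈ P.spherical := by
  constructor
  · rintro ⟨c, rfl⟩
    exact ⟨c, c.2, rfl⟩
  · rintro ⟨c, hc, h⟩
    exact ⟨⟨c, hc⟩, Subtype.ext h⟩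

theorem exists_fill (g h : P.Grp) : ∃ y, P.d2 y =
    P.pathTo g + MonoidAlgebra.of ℤ P.Grp g • P.pathTo h - P.pathTo (g * h) := by
  have : P.pathTo g + MonoidAlgebra.of ℤ P.Grp g • P.pathTo h - P.pathTo (g * h) ∈
      LinearMap.ker P.d1 := by
    rw [LinearMap.mem_ker, map_sub, map_add, map_smul, d1_pathTo, d1_pathTo, d1_pathTo,
      smul_eq_mul, mul_sub, mul_one, map_mul]
    abel
  rwa [ker_d1_eq_range_d2] at this

/-- The comparison map `ℤ[G²] → C₂(K̃)`. -/
noncomputable def fill : (P.Grp × P.Grp →₀ ℤ) →+ (Fin P.n → P.ZG) :=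
  basisLift fun p => (P.exists_fill p.1 p.2).choose

theorem d2_fill_single (g h : P.Grp) : P.d2 (P.fill (Finsupp.single (g, h) 1)) =
    P.pathTo g + MonoidAlgebra.of ℤ P.Grp g • P.pathTo h - P.pathTo (g * h) := by
  rw [fill, basisLift_single]
  exact (P.exists_fill g h).choose_spec

theorem proj_fill_mem {z : P.Grp × P.Grp →₀ ℤ} (hz : z ∈ P.barB) :
    P.proj P.n (P.fill z) ∈ P.spherical := by
  rw [← QuotientAddGroup.eq_zero_iff]
  refine P.barB_induction (((QuotientAddGroup.mk' P.spherical).comp (P.proj P.n)).comp P.fill)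
    (fun g h j => ?_) hz
  change QuotientAddGroup.mk' P.spherical (P.proj P.n (P.fill _)) = 0
  rw [QuotientAddGroup.mk'_apply, QuotientAddGroup.eq_zero_iff]
  -- The four fillings of the faces of `[g|h|j]` fit together to a closed 2-cycle of the cover once
  -- the first one is translated by `g`; the projection forgets this translation.
  refine ⟨MonoidAlgebra.of ℤ P.Grp g • P.fill (Finsupp.single (h, j) 1)
    - P.fill (Finsupp.single (g * h, j) 1)
    + P.fill (Finsupp.single (g, h * j) 1) - P.fill (Finsupp.single (g, h) 1), ?_, ?_⟩
  · change P.d2 _ = 0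
    simp only [map_sub, map_add, map_smul, d2_fill_single, smul_sub, smul_add, mul_assoc,
      map_mul, ← mul_smul]
    abel
  · simp only [map_sub, map_add, proj_smul, aug_of, one_smul]

theorem exists_edge_fill (x : Fin P.m) : ∃ q, P.d2 q =
    P.pathTo (PresentedGroup.of x) - cell 1 x := by
  have : P.pathTo (PresentedGroup.of x) - cell 1 x ∈ LinearMap.ker P.d1 := by
    rw [LinearMap.mem_ker, map_sub, d1_pathTo, d1_cell, one_mul, map_one, sub_self]
  rwa [ker_d1_eq_range_d2] at this

/-- A chain `z` of `K̃` differs from the boundary of its image under the comparison maps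
by a natural homotopy. -/
theorem exists_proj_fill_compare (z : Fin P.m → P.ZG) (h1 : P.d1 z = 0) (h0 : P.proj P.m z = 0) :
    ∃ q, P.proj P.n q = 0 ∧ P.d2 (P.fill (P.compare z)) = z + P.d2 q := by
  choose q hq using P.exists_edge_fill
  -- `q x` fills the loop between the chosen path to `x` and the edge `x`. Spreading it
  -- equivariantly makes the projection of `Q` factor through that of the 1-chain.
  let Q : (Fin P.m → P.ZG) →+ (Fin P.n → P.ZG) :=
    chainLift fun h x => MonoidAlgebra.of ℤ P.Grp h • q x
  have hproj : (P.proj P.n).comp Q =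
      (Fintype.linearCombination ℤ fun x => P.proj P.n (q x)).toAddMonoidHom.comp (P.proj P.m) :=
    chain_hom_ext fun g x => by
      change P.proj P.n (Q (cell g x)) = Fintype.linearCombination ℤ _ (P.proj P.m (cell g x))
      rw [chainLift_cell, proj_cell, Fintype.linearCombination_apply_single, one_smul, proj_smul,
        aug_of, one_smul]
  have hd : (P.d2.toAddMonoidHom.comp P.fill).comp P.compare =
      AddMonoidHom.id _ + P.d2.toAddMonoidHom.comp Q - (zgLift P.pathTo).comp P.d1.toAddMonoidHom :=
    chain_hom_ext fun g x => by
      change P.d2 (P.fill (P.compare (cell g x))) =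
        cell g x + P.d2 (Q (cell g x)) - zgLift P.pathTo (P.d1 (cell g x))
      rw [compare, chainLift_cell, d2_fill_single, chainLift_cell, map_smul, hq, d1_cell, map_sub,
        zgLift_of, zgLift_of, smul_sub, of_smul_cell, mul_one]
      abel
  refine ⟨Q z, ?_, ?_⟩
  · have := DFunLike.congr_fun hproj z
    change P.proj P.n (Q z) = Fintype.linearCombination ℤ _ (P.proj P.m z) at this
    rw [this, h0, map_zero]
  · have := DFunLike.congr_fun hd z
    change P.d2 (P.fill (P.compare z)) = z + P.d2 (Q z) - zgLift P.pathTo (P.d1 z) at this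
    rw [this, h1, map_zero, sub_zero]

/-- Lift `v` to a chain `c`. Up to a chain `q` with zero projection, `c` and the filling of the bar
image of its boundary have the same boundary, so they differ by a spherical cycle. If the bar image
bounds, its filling projects to a spherical cycle as well. Conversely, a 2-cycle `c` has bar image
zero. -/
theorem hopfChain_mem_iff (v : Fin P.n → ℤ) (hv : P.dK2 v = 0) :
    P.hopfChain v ∈ P.barB ↔ v ∈ P.spherical := by
  constructor
  · intro h
    obtain ⟨c, rfl⟩ := P.proj_surjective P.n v
    have hmem : P.compare (P.d2 c) ∈ P.barB := by
      rw [← Submodule.Quotient.mk_eq_zero, ← Submodule.mkQ_apply, ← mk_hopfChain_proj,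
        Submodule.mkQ_apply, Submodule.Quotient.mk_eq_zero]
      exact h
    rw [dK2_proj] at hv
    obtain ⟨q, hq, hd⟩ := P.exists_proj_fill_compare (P.d2 c)
      (LinearMap.congr_fun P.d1_comp_d2 c) hv
    have hs : P.proj P.n (c + q - P.fill (P.compare (P.d2 c))) ∈ P.spherical :=
      ⟨_, by change P.d2 _ = 0; rw [map_sub, map_add, hd, sub_self], rfl⟩
    have := P.spherical.add_mem hs (P.proj_fill_mem hmem)
    rwa [map_sub, map_add, hq, add_zero, sub_add_cancel] at this
  · rintro ⟨c, hc, rfl⟩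
    have hc' : P.d2 c = 0 := hc
    rw [← Submodule.Quotient.mk_eq_zero, ← Submodule.mkQ_apply]
    change P.barB.mkQ (P.hopfChain (P.proj P.n c)) = 0
    rw [mk_hopfChain_proj, hc', map_zero, map_zero]

/-- The cycle `v` is the projection of the filling of `z`. Going from the bar complex to `K̃` and
back is the identity modulo boundaries, up to a term that factors through `barD`. -/
theorem exists_hopfChain_sub_mem (z : P.Grp × P.Grp →₀ ℤ) (hz : P.barD z = 0) :
    ∃ v, P.dK2 v = 0 ∧ P.hopfChain v - z ∈ P.barB := by
  have h1 : (P.proj P.m).comp (P.d2.toAddMonoidHom.comp P.fill) =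
      (basisLift fun g => P.proj P.m (P.pathTo g)).comp P.barD := basis_hom_ext fun ⟨g, h⟩ => by
    change P.proj P.m (P.d2 (P.fill (Finsupp.single (g, h) 1))) = basisLift _ (P.barD _)
    rw [d2_fill_single, barD_single]
    simp only [map_add, map_sub, proj_smul, aug_of, one_smul, basisLift_single]
    abel
  have h2 : (P.barB.mkQ.toAddMonoidHom.comp P.compare).comp (P.d2.toAddMonoidHom.comp P.fill) =
      P.barB.mkQ.toAddMonoidHom + (basisLift fun g => P.barB.mkQ (P.compare (P.pathTo g)) -
        P.barB.mkQ (Finsupp.single (1, 1) 1)).comp P.barD := basis_hom_ext fun ⟨g, h⟩ => by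
    change P.barB.mkQ (P.compare (P.d2 (P.fill (Finsupp.single (g, h) 1)))) =
      P.barB.mkQ (Finsupp.single (g, h) 1) + basisLift _ (P.barD _)
    -- Degenerate cells: the boundary of `[g|1|1]` identifies `[g|1]` with `[1|1]`, which leaves a
    -- constant to be absorbed in the homotopy.
    have hg : P.barB.mkQ (Finsupp.single (g, 1) 1) = P.barB.mkQ (Finsupp.single (1, 1) 1) := by
      rw [Submodule.mkQ_apply, Submodule.mkQ_apply, eq_comm, Submodule.Quotient.eq]
      have := P.barB_relation g 1 1
      simpa using this
    have hone : (1 : P.ZG) = MonoidAlgebra.of ℤ P.Grp 1 := (map_one _).symm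
    rw [d2_fill_single, barD_single, map_sub, map_add, map_sub, map_add, mk_compare_smul, d1_pathTo]
    simp only [map_sub, map_add, zgLift_of, hone, basisLift_single, hg]
    abel
  refine ⟨P.proj P.n (P.fill z), ?_, ?_⟩
  · have := DFunLike.congr_fun h1 z
    change P.proj P.m (P.d2 (P.fill z)) = basisLift _ (P.barD z) at this
    rw [dK2_proj, this, hz, map_zero]
  · have := DFunLike.congr_fun h2 z
    change P.barB.mkQ (P.compare (P.d2 (P.fill z))) = P.barB.mkQ z + basisLift _ (P.barD z) at this
    rw [hz, map_zero, add_zero, ← mk_hopfChain_proj] at this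
    exact (Submodule.Quotient.eq _).1 this

/-- The Hopf epimorphism `H₂(K) → H₂(G)`. -/
noncomputable def hopf : P.H2 →ₗ[ℤ] P.groupH2 :=
  (groupHomology.H2π P.trivRep).hom.comp
    ((P.hopfChain.comp P.H2.subtype).codRestrict (groupHomology.cycles₂ P.trivRep)
      fun v => P.barD_hopfChain v v.2)

theorem hopf_surjective : Function.Surjective P.hopf := by
  intro y
  obtain ⟨z, rfl⟩ := (ModuleCat.epi_iff_surjective (groupHomology.H2π P.trivRep)).1 inferInstance y
  obtain ⟨v, hv, hB⟩ := P.exists_hopfChain_sub_mem z.1 z.2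
  refine ⟨⟨v, hv⟩, ?_⟩
  exact (groupHomology.H2π_eq_iff (A := P.trivRep) _ _).2 hB

theorem ker_hopf : LinearMap.ker P.hopf = P.sigma := by
  ext v
  rw [mem_sigma_iff, ← hopfChain_mem_iff P v v.2, LinearMap.mem_ker]
  exact groupHomology.H2π_eq_zero_iff (A := P.trivRep) _

end FinPresentation

namespace FinPresentation

variable (P : FinPresentation)

/-! ### Projectivity of the relation module -/

/-- The augmentation, with values in the module that corresponds to the trivial representation. -/
noncomputable def augMap : P.ZG →ₗ[P.ZG] P.trivRep.ρ.asModule :=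
  LinearMap.toSpanSingleton P.ZG _ (P.trivRep.ρ.asModuleEquiv.symm (1 : ℤ))

theorem augMap_of (g : P.Grp) :
    P.augMap (MonoidAlgebra.of ℤ P.Grp g) = P.trivRep.ρ.asModuleEquiv.symm (1 : ℤ) := by
  rw [augMap, LinearMap.toSpanSingleton_apply]
  exact (Representation.asModuleEquiv_symm_map_rho P.trivRep.ρ g (1 : ℤ)).symm

theorem augMap_apply (a : P.ZG) :
    P.augMap a = P.trivRep.ρ.asModuleEquiv.symm (P.aug a : ℤ) := by
  have : P.augMap.toAddMonoidHom =
      P.trivRep.ρ.asModuleEquiv.symm.toLinearMap.toAddMonoidHom.comp P.aug.toAddMonoidHom :=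
    zg_hom_ext fun g => by
      change P.augMap (MonoidAlgebra.of ℤ P.Grp g) =
        P.trivRep.ρ.asModuleEquiv.symm (P.aug (MonoidAlgebra.of ℤ P.Grp g) : ℤ)
      rw [augMap_of, aug_of]
  exact DFunLike.congr_fun this a

theorem augMap_surjective : Function.Surjective P.augMap := by
  intro y
  refine ⟨((P.trivRep.ρ.asModuleEquiv y : ℤ) : P.ZG), ?_⟩
  rw [augMap_apply, map_intCast]
  exact P.trivRep.ρ.asModuleEquiv.symm_apply_apply y

theorem mem_ker_augMap {a : P.ZG} : a ∈ LinearMap.ker P.augMap ↔ P.aug a = 0 := by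
  rw [LinearMap.mem_ker, augMap_apply]
  exact P.trivRep.ρ.asModuleEquiv.symm.map_eq_zero_iff

theorem d1_zgLift_pathTo (a : P.ZG) : P.d1 (zgLift P.pathTo a) = a - (P.aug a : P.ZG) := by
  have : P.d1.toAddMonoidHom.comp (zgLift P.pathTo) =
      AddMonoidHom.id P.ZG - (Int.castAddHom P.ZG).comp P.aug.toAddMonoidHom :=
    zg_hom_ext fun g => by
      change P.d1 (zgLift P.pathTo (MonoidAlgebra.of ℤ P.Grp g)) =
        MonoidAlgebra.of ℤ P.Grp g - (P.aug (MonoidAlgebra.of ℤ P.Grp g) : P.ZG)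
      rw [zgLift_of, d1_pathTo, aug_of, Int.cast_one]
  exact DFunLike.congr_fun this a

theorem d1_mem_ker_augMap (c : Fin P.m → P.ZG) : P.d1 c ∈ LinearMap.ker P.augMap := by
  have : P.aug.toAddMonoidHom.comp P.d1.toAddMonoidHom = 0 := chain_hom_ext fun g x => by
    change P.aug (P.d1 (cell g x)) = 0
    rw [d1_cell, map_sub, aug_of, aug_of, sub_self]
  exact P.mem_ker_augMap.2 (DFunLike.congr_fun this c)

/-- The boundary `C₁(K̃) → I` onto the augmentation ideal. -/
noncomputable def d1' : (Fin P.m → P.ZG) →ₗ[P.ZG] LinearMap.ker P.augMap :=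
  P.d1.codRestrict _ P.d1_mem_ker_augMap

theorem d1'_surjective : Function.Surjective P.d1' := by
  rintro ⟨a, ha⟩
  refine ⟨zgLift P.pathTo a, Subtype.ext ?_⟩
  change P.d1 _ = a
  rw [d1_zgLift_pathTo, P.mem_ker_augMap.1 ha, Int.cast_zero, sub_zero]

theorem ker_d1' : LinearMap.ker P.d1' = P.Z1cover := LinearMap.ker_codRestrict _ _ _

/-- Dimension shifting along the augmentation `ℤ[G] → ℤ` and then along `C₁(K̃) → I`, with `I` the
augmentation ideal: both middle terms are free, so each step lowers the bound on the projective
dimension by one. -/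
theorem projective_Z1cover (h : P.HasCdTwo) : Module.Projective P.ZG P.Z1cover := by
  -- The dimension hypothesis lives in `Rep`, the chain modules in `ModuleCat`; the equivalence
  -- between them preserves and reflects projectivity.
  let F : ModuleCat P.ZG ⥤ Rep ℤ P.Grp := Rep.ofModuleMonoidAlgebra
  have hF : ∀ X : ModuleCat P.ZG, Projective X → Projective (F.obj X) := fun X hX =>
    Rep.equivalenceModuleMonoidAlgebra.symm.toAdjunction.map_projective X hX
  have s1 := (LinearMap.shortExact_shortComplexKer P.augMap_surjective).map_of_exact F
  have s2 := (LinearMap.shortExact_shortComplexKer P.d1'_surjective).map_of_exact F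
  have p0 : Projective (F.obj (ModuleCat.of P.ZG P.ZG)) :=
    hF _ ((IsProjective.iff_projective _).1 inferInstance)
  have p1 : Projective (F.obj (ModuleCat.of P.ZG (Fin P.m → P.ZG))) :=
    hF _ ((IsProjective.iff_projective _).1 inferInstance)
  have h3 : HasProjectiveDimensionLT P.trivRep 3 :=
    (projectiveDimension_le_iff _ 2).1 h.le
  have h3' : HasProjectiveDimensionLT
      (F.obj (ModuleCat.of P.ZG P.trivRep.ρ.asModule)) 3 :=
    hasProjectiveDimensionLT_of_iso (Rep.unitIso P.trivRep) 3
  have h2 := (s1.hasProjectiveDimensionLT_X₃_iff 1 p0).1 h3'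
  have h1 := (s2.hasProjectiveDimensionLT_X₃_iff 0 p1).1 h2
  have pZ : Projective (F.obj (ModuleCat.of P.ZG (LinearMap.ker P.d1'))) :=
    projective_iff_hasProjectiveDimensionLT_one.2 h1
  have pZ' : Projective (ModuleCat.of P.ZG (LinearMap.ker P.d1')) :=
    Rep.equivalenceModuleMonoidAlgebra.symm.toAdjunction.projective_of_map_projective _ pZ
  rw [← ker_d1']
  exact (IsProjective.iff_projective _).2 pZ'

/-! ### Spherical cycles form a direct summand -/

theorem exists_section (h : P.HasCdTwo) :
    ∃ s : P.Z1cover →ₗ[P.ZG] (Fin P.n → P.ZG), ∀ z, P.d2 (s z) = z := by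
  have := P.projective_Z1cover h
  let d2' : (Fin P.n → P.ZG) →ₗ[P.ZG] P.Z1cover :=
    P.d2.codRestrict _ fun c => P.range_d2_le ⟨c, rfl⟩
  have hs : Function.Surjective d2' := by
    rintro ⟨z, hz⟩
    obtain ⟨c, rfl⟩ : z ∈ LinearMap.range P.d2 := P.ker_d1_eq_range_d2 ▸ hz
    exact ⟨c, rfl⟩
  obtain ⟨s, hs⟩ := Module.projective_lifting_property d2' LinearMap.id hs
  exact ⟨s, fun z => congrArg Subtype.val (LinearMap.congr_fun hs z)⟩

/-- The spherical cycles, as a submodule of `ℤⁿ`. -/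
noncomputable def sphericalModule : Submodule ℤ (Fin P.n → ℤ) :=
  AddSubgroup.toIntSubmodule P.spherical

theorem sphericalModule_le_H2 : P.sphericalModule ≤ P.H2 := by
  rintro _ ⟨c, hc, rfl⟩
  have hc' : P.d2 c = 0 := hc
  change P.dK2 (P.proj P.n c) = 0
  rw [dK2_proj, hc', map_zero]

theorem sigma_eq_comap : P.sigma = P.sphericalModule.comap P.H2.subtype := by
  ext v
  exact P.mem_sigma_iff

theorem map_sigma : P.sigma.map P.H2.subtype = P.sphericalModule := by
  rw [sigma_eq_comap, Submodule.map_comap_subtype, inf_eq_right]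
  exact P.sphericalModule_le_H2

/-- The projection is the augmentation of `1 - s ∘ d2`, which retracts `C₂(K̃)` onto `H₂(K̃)` for a
section `s` over the relation module. -/
theorem exists_projection_sphericalModule (h : P.HasCdTwo) :
    ∃ p : (Fin P.n → ℤ) →ₗ[ℤ] (Fin P.n → ℤ),
      (∀ v, p v ∈ P.sphericalModule) ∧ ∀ v ∈ P.sphericalModule, p v = v := by
  obtain ⟨s, hs⟩ := P.exists_section h
  let d2' : (Fin P.n → P.ZG) →ₗ[P.ZG] P.Z1cover :=
    P.d2.codRestrict _ fun c => P.range_d2_le ⟨c, rfl⟩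
  refine ⟨P.bar (LinearMap.id - s ∘ₗ d2'), fun v => ?_, ?_⟩
  · obtain ⟨c, rfl⟩ := P.proj_surjective _ v
    refine ⟨(LinearMap.id - s ∘ₗ d2' : (Fin P.n → P.ZG) →ₗ[P.ZG] _) c, ?_, (P.bar_proj _ c).symm⟩
    change P.d2 (c - s (d2' c)) = 0
    rw [map_sub, hs]
    exact sub_self _
  · rintro _ ⟨c, hc, rfl⟩
    have : d2' c = 0 := Subtype.ext hc
    rw [bar_proj]
    change P.proj P.n (c - s (d2' c)) = _
    rw [this, map_zero, sub_zero]

theorem exists_isCompl_sigma (h : P.HasCdTwo) : ∃ T : Submodule ℤ P.H2, IsCompl P.sigma T := by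
  obtain ⟨p, hp, hp'⟩ := P.exists_projection_sphericalModule h
  let q : P.H2 →ₗ[ℤ] P.sigma :=
    ((p ∘ₗ P.H2.subtype).codRestrict P.H2 fun v => P.sphericalModule_le_H2 (hp _)).codRestrict
      P.sigma fun v => P.mem_sigma_iff.2 (hp _)
  exact ⟨_, LinearMap.isCompl_of_proj (f := q) fun v =>
    Subtype.ext (Subtype.ext (hp' _ (P.mem_sigma_iff.1 v.2)))⟩

/-- If `a • v` is spherical, the projection `p` fixes it; cancelling `a` in `ℤⁿ` gives `p v = v`, so
`v` is spherical. -/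
theorem groupH2_torsionFree (h : P.HasCdTwo) (a : ℤ) (x : P.groupH2) (hx : a • x = 0) :
    a = 0 ∨ x = 0 := by
  obtain ⟨p, hp, hp'⟩ := P.exists_projection_sphericalModule h
  obtain ⟨v, rfl⟩ := P.hopf_surjective x
  rw [← map_zsmul, ← LinearMap.mem_ker, ker_hopf, mem_sigma_iff] at hx
  rw [← LinearMap.mem_ker, ker_hopf, mem_sigma_iff, or_iff_not_imp_left]
  intro ha
  have h1 := hp' _ hx
  rw [Submodule.coe_smul, map_smul] at h1
  have h2 := smul_right_injective _ ha h1
  rw [← h2]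
  exact hp _

/-! ### The rank of the group of spherical cycles -/

theorem bar_vecMulLinear_trace (E : Matrix (Fin P.n) (Fin P.n) P.ZG) :
    LinearMap.trace ℤ _ (P.bar E.vecMulLinear) = ∑ i, P.aug (E i i) := by
  rw [LinearMap.trace_eq_matrix_trace ℤ (Pi.basisFun ℤ (Fin P.n)), Matrix.trace]
  refine Finset.sum_congr rfl fun i _ => ?_
  rw [Matrix.diag_apply, LinearMap.toMatrix_apply, Pi.basisFun_apply, Pi.basisFun_repr,
    bar, Fintype.linearCombination_apply_single, one_smul, proj_apply, Matrix.vecMulLinear_apply,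
    Matrix.single_one_vecMul]
  rfl

/-- `ker E` and `H₂(K̃)` are isomorphic with isomorphic complements, hence conjugate under an
automorphism of `C₂(K̃)`. Augmentation turns this into an isomorphism from the image of an integral
idempotent to `Σ_K`, and the rank of an idempotent is its trace. -/
theorem finrank_sphericalModule {E : Matrix (Fin P.n) (Fin P.n) P.ZG} (hcd : P.HasCdTwo)
    (hE : E * E = E) (e1 : LinearMap.range E.vecMulLinear ≃ₗ[P.ZG] P.Z1cover)
    (e2 : LinearMap.ker E.vecMulLinear ≃ₗ[P.ZG] P.H2cover) :
    (Module.finrank ℤ P.sphericalModule : ℤ) + ∑ i, P.aug (E i i) = P.n := by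
  obtain ⟨s, hs⟩ := P.exists_section hcd
  have hidem : IsIdempotentElem E.vecMulLinear := LinearMap.ext fun v => by
    change Matrix.vecMul (Matrix.vecMul v E) E = Matrix.vecMul v E
    rw [Matrix.vecMul_vecMul, hE]
  have hsinj : Function.Injective s := fun z z' h => Subtype.ext (by rw [← hs z, ← hs z', h])
  have hc1 : IsCompl (LinearMap.ker E.vecMulLinear) (LinearMap.range E.vecMulLinear) :=
    (LinearMap.IsIdempotentElem.isProj_range _ hidem).isCompl.symm
  have hc2 : IsCompl P.H2cover (LinearMap.range s) := by
    refine IsCompl.of_eq ?_ ?_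
    · rw [eq_bot_iff]
      rintro _ ⟨h, z, rfl⟩
      have : z = 0 := Subtype.ext (by rw [← hs z]; exact h)
      rw [this, map_zero]
      exact zero_mem _
    · rw [eq_top_iff]
      intro c _
      have hz : P.d2 c ∈ P.Z1cover := P.range_d2_le ⟨c, rfl⟩
      rw [Submodule.mem_sup]
      refine ⟨c - s ⟨_, hz⟩, ?_, s ⟨_, hz⟩, ⟨_, rfl⟩, sub_add_cancel _ _⟩
      rw [LinearMap.mem_ker, map_sub, hs, sub_self]
  -- The automorphism matches `ker E ⊕ im E` with `H₂(K̃) ⊕ s(Z₁(K̃))`, summand by summand.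
  let A : (Fin P.n → P.ZG) ≃ₗ[P.ZG] (Fin P.n → P.ZG) :=
    (Submodule.prodEquivOfIsCompl _ _ hc1).symm ≪≫ₗ
      (e2.prodCongr (e1 ≪≫ₗ LinearEquiv.ofInjective s hsinj)) ≪≫ₗ
      Submodule.prodEquivOfIsCompl _ _ hc2
  have hA : ∀ c : LinearMap.ker E.vecMulLinear, A c = e2 c := fun c => by
    have : (Submodule.prodEquivOfIsCompl _ _ hc1).symm (c : Fin P.n → P.ZG) = (c, 0) :=
      Submodule.prodEquivOfIsCompl_symm_apply_left _ _ hc1 c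
    simp [A, this]
  let Abar : (Fin P.n → ℤ) ≃ₗ[ℤ] (Fin P.n → ℤ) :=
    LinearEquiv.ofLinearMap (P.bar A.toLinearMap) (P.bar A.symm.toLinearMap)
      (by rw [← bar_comp, LinearEquiv.comp_symm, bar_id])
      (by rw [← bar_comp, LinearEquiv.symm_comp, bar_id])
  let Q := LinearMap.id - P.bar E.vecMulLinear
  have hQ : IsIdempotentElem Q := by
    have : IsIdempotentElem (P.bar E.vecMulLinear) := by
      change P.bar E.vecMulLinear ∘ₗ P.bar E.vecMulLinear = _
      rw [← bar_comp]
      exact congrArg P.bar hidem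
    exact this.one_sub
  have hQproj : ∀ c, Q (P.proj P.n c) = P.proj P.n (c - Matrix.vecMul c E) := fun c => by
    change P.proj P.n c - P.bar _ (P.proj P.n c) = _
    rw [bar_proj, map_sub]
    rfl
  -- `ker E` is the image of `1 - E`, so it projects onto the range of `Q`.
  have hmap : P.sphericalModule = (LinearMap.range Q).map Abar.toLinearMap := by
    ext v
    constructor
    · rintro ⟨c, hc, rfl⟩
      have hk : Matrix.vecMul (e2.symm ⟨c, hc⟩ : Fin P.n → P.ZG) E = 0 := (e2.symm ⟨c, hc⟩).2
      refine ⟨P.proj P.n (e2.symm ⟨c, hc⟩), ⟨P.proj P.n (e2.symm ⟨c, hc⟩), ?_⟩, ?_⟩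
      · rw [hQproj, hk, sub_zero]
      · change P.bar A.toLinearMap _ = _
        rw [bar_proj]
        change P.proj P.n (A _) = _
        rw [hA, LinearEquiv.apply_symm_apply]
    · rintro ⟨_, ⟨w, rfl⟩, rfl⟩
      obtain ⟨c, rfl⟩ := P.proj_surjective _ w
      have hk : c - Matrix.vecMul c E ∈ LinearMap.ker E.vecMulLinear := by
        change Matrix.vecMul (c - Matrix.vecMul c E) E = 0
        rw [Matrix.sub_vecMul, Matrix.vecMul_vecMul, hE, sub_self]
      refine ⟨A (c - Matrix.vecMul c E), ?_, ?_⟩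
      · rw [hA ⟨_, hk⟩]
        exact (e2 _).2
      · rw [hQproj]
        exact (P.bar_proj A.toLinearMap _).symm
  have htr := (LinearMap.IsIdempotentElem.isProj_range _ hQ).trace
  rw [map_sub, bar_vecMulLinear_trace, LinearMap.trace_id, Module.finrank_fin_fun] at htr
  rw [hmap, LinearEquiv.finrank_map_eq, ← htr, sub_add_cancel]

end FinPresentation

namespace FinPresentation

variable (P : FinPresentation)

/-! ### Identity sequences -/

/-- The word `u r^{±1} u⁻¹` for a triple consisting of `u`, the index of a relator `r`, and a
sign. -/
def conjWord (R : List (List (ℕ × Bool))) (t : List (ℕ × Bool) × ℕ × Bool) : List (ℕ × Bool) :=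
  t.1 ++ (cond t.2.2 (R.getD t.2.1 []) (FreeGroup.invRev (R.getD t.2.1 [])) ++
    FreeGroup.invRev t.1)

/-- The word spelled by a sequence of conjugates of relators. -/
def seqWord (R : List (List (ℕ × Bool))) (W : List (List (ℕ × Bool) × ℕ × Bool)) :
    List (ℕ × Bool) :=
  W.flatMap (conjWord R)

/-- The number of occurrences, with signs, of the relator with index `j` in a sequence. -/
def signCount (W : List (List (ℕ × Bool) × ℕ × Bool)) (j : ℕ) : ℤ :=
  (W.map fun t => if t.2.1 = j then cond t.2.2 1 (-1) else 0).sum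

/-- The list of the relators. -/
def codeRel : List (List (ℕ × Bool)) := List.ofFn fun i => P.codeWord (P.rel i)

theorem codeRel_getD (i : Fin P.n) : P.codeRel.getD i [] = P.codeWord (P.rel i) := by
  simp [codeRel, List.getD_eq_getElem?_getD]

theorem codeRel_getD_of_le {i : ℕ} (hi : P.n ≤ i) : P.codeRel.getD i [] = [] := by
  simp [codeRel, List.getD_eq_getElem?_getD, hi]

/-! #### Identity sequences give spherical cycles -/

theorem pathChain_step {u v : P.Word} (h : FreeGroup.Red.Step u v) (g : P.Grp) :
    P.pathChain g u = P.pathChain g v := by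
  rcases h with @⟨u, v, x, b⟩
  rw [pathChain_append, pathChain_append]
  congr 1
  rcases b with _ | _ <;> simp [pathChain]

theorem pathChain_eq_of_mk_eq {u v : P.Word} (h : FreeGroup.mk u = FreeGroup.mk v) (g : P.Grp) :
    P.pathChain g u = P.pathChain g v := by
  have hred : ∀ {u v : P.Word}, FreeGroup.Red u v → P.pathChain g u = P.pathChain g v := by
    intro u v h
    induction h with
    | refl => rfl
    | tail _ h ih => rw [ih, P.pathChain_step h]
  obtain ⟨w, hu, hv⟩ := FreeGroup.Red.exact.1 h
  rw [hred hu, hred hv]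

theorem wordValue_invRev (w : P.Word) : P.wordValue (FreeGroup.invRev w) = (P.wordValue w)⁻¹ := by
  rw [wordValue, wordValue, ← FreeGroup.inv_mk, map_inv]

theorem pathChain_invRev (g : P.Grp) (w : P.Word) :
    P.pathChain g (FreeGroup.invRev w) = -P.pathChain (g * (P.wordValue w)⁻¹) w := by
  rw [eq_neg_iff_add_eq_zero, ← wordValue_invRev, ← pathChain_append,
    P.pathChain_eq_of_mk_eq (v := [])]
  · rfl
  · rw [← FreeGroup.mul_mk, ← FreeGroup.inv_mk, inv_mul_cancel, FreeGroup.one_eq_mk]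

/-- The word in the generators obtained by deleting the letters that are out of range. -/
def decodeWord (w : List (ℕ × Bool)) : P.Word :=
  w.filterMap fun a => if h : a.1 < P.m then some (⟨a.1, h⟩, a.2) else none

theorem decodeWord_append (u v : List (ℕ × Bool)) :
    P.decodeWord (u ++ v) = P.decodeWord u ++ P.decodeWord v := List.filterMap_append

theorem decodeWord_codeWord (w : P.Word) : P.decodeWord (P.codeWord w) = w := by
  simp [decodeWord, codeWord, List.filterMap_map]

theorem decodeWord_invRev (w : List (ℕ × Bool)) :
    P.decodeWord (FreeGroup.invRev w) = FreeGroup.invRev (P.decodeWord w) := by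
  rw [FreeGroup.invRev, FreeGroup.invRev, decodeWord, decodeWord, List.filterMap_reverse,
    List.filterMap_map, List.map_filterMap]
  congr 2
  funext a
  by_cases h : a.1 < P.m <;> simp [h]

/-- Words in a certificate may contain letters that are not generators. Deleting these is the
homomorphism of free groups that kills them, so free triviality survives. -/
theorem lift_mk_eq_mk_decodeWord (w : List (ℕ × Bool)) :
    FreeGroup.lift (fun i => if h : i < P.m then FreeGroup.of (⟨i, h⟩ : Fin P.m) else 1)
      (FreeGroup.mk w) = FreeGroup.mk (P.decodeWord w) := by
  induction w with
  | nil => rw [← FreeGroup.one_eq_mk, map_one]; rfl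
  | cons a w ih =>
    have : FreeGroup.mk (a :: w) = FreeGroup.mk [a] * FreeGroup.mk w := by
      rw [FreeGroup.mul_mk]; rfl
    have hd : P.decodeWord (a :: w) = P.decodeWord [a] ++ P.decodeWord w :=
      P.decodeWord_append [a] w
    rw [this, map_mul, ih, hd, ← FreeGroup.mul_mk]
    congr 1
    rcases a with ⟨i, b⟩
    by_cases h : i < P.m
    · rcases b with _ | _ <;> simp [decodeWord, h, FreeGroup.of, FreeGroup.invRev]
    · rcases b with _ | _ <;> simp [decodeWord, h, FreeGroup.one_eq_mk]

theorem mk_decodeWord_eq_one {w : List (ℕ × Bool)} (h : FreeGroup.mk w = 1) :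
    FreeGroup.mk (P.decodeWord w) = 1 := by
  rw [← lift_mk_eq_mk_decodeWord, h, map_one]

/-- The path goes out along `u`, around a relator and back, so its chain is the boundary of a
translated 2-cell, up to sign. -/
theorem exists_chain_of_conj (t : List (ℕ × Bool) × ℕ × Bool) :
    ∃ c, P.d2 c = P.pathChain 1 (P.decodeWord (conjWord P.codeRel t)) ∧
      (∀ j, P.proj P.n c j = if t.2.1 = j then cond t.2.2 1 (-1) else 0) ∧
      P.wordValue (P.decodeWord (conjWord P.codeRel t)) = 1 := by
  obtain ⟨u, i, b⟩ := t
  by_cases hi : i < P.n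
  · have hr := P.codeRel_getD ⟨i, hi⟩
    dsimp only at hr
    have hd : P.d2 (cell (P.wordValue (P.decodeWord u)) ⟨i, hi⟩) =
        P.pathChain (P.wordValue (P.decodeWord u)) (P.rel ⟨i, hi⟩) := by
      rw [d2_cell, of_smul_pathChain, mul_one]
    have hc : ∀ j : Fin P.n, (Pi.single (⟨i, hi⟩ : Fin P.n) (1 : ℤ) : Fin P.n → ℤ) j =
        if i = j then 1 else 0 := fun j => by
      rw [Pi.single_apply]
      exact if_congr ⟨fun h => by rw [h], fun h => Fin.ext h.symm⟩ rfl rfl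
    rcases b with _ | _
    · refine ⟨-cell (P.wordValue (P.decodeWord u)) ⟨i, hi⟩, ?_, fun j => ?_, ?_⟩
      · simp only [conjWord, hr, cond_false, decodeWord_append, decodeWord_invRev,
          decodeWord_codeWord, pathChain_append, pathChain_invRev, wordValue_invRev, wordValue_rel]
        simp [hd]
      · rw [map_neg, proj_cell, Pi.neg_apply, hc]
        dsimp only
        split_ifs <;> rfl
      · simp only [conjWord, hr, cond_false, decodeWord_append, decodeWord_invRev,
          decodeWord_codeWord, wordValue_append, wordValue_invRev, wordValue_rel]
        simp
    · refine ⟨cell (P.wordValue (P.decodeWord u)) ⟨i, hi⟩, ?_, fun j => ?_, ?_⟩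
      · simp only [conjWord, hr, cond_true, decodeWord_append, decodeWord_invRev,
          decodeWord_codeWord, pathChain_append, pathChain_invRev, wordValue_rel]
        simp [hd]
      · rw [proj_cell, hc]
        rfl
      · simp only [conjWord, hr, cond_true, decodeWord_append, decodeWord_invRev,
          decodeWord_codeWord, wordValue_append, wordValue_invRev, wordValue_rel]
        simp
  -- An index out of range reads the empty word as relator; the conjugate is freely trivial and
  -- counts for no 2-cell.
  · have hw : conjWord P.codeRel (u, i, b) = u ++ FreeGroup.invRev u := by
      have hnil := P.codeRel_getD_of_le (not_lt.1 hi)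
      rcases b with _ | _ <;> simp only [conjWord, hnil] <;> rfl
    refine ⟨0, ?_, fun j => ?_, ?_⟩
    · rw [hw, decodeWord_append, decodeWord_invRev, pathChain_append, pathChain_invRev]
      simp
    · have : ¬ i = j := fun h => hi (h ▸ j.2)
      simp [this]
    · rw [hw, decodeWord_append, decodeWord_invRev, wordValue_append, wordValue_invRev,
        mul_inv_cancel]

theorem exists_chain_of_seq (W : List (List (ℕ × Bool) × ℕ × Bool)) :
    ∃ c, P.d2 c = P.pathChain 1 (P.decodeWord (seqWord P.codeRel W)) ∧
      (∀ j, P.proj P.n c j = signCount W j) ∧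
      P.wordValue (P.decodeWord (seqWord P.codeRel W)) = 1 := by
  induction W with
  | nil => exact ⟨0, by rw [map_zero]; rfl, fun j => by simp [signCount], rfl⟩
  | cons t W ih =>
    obtain ⟨c, hc, hp, hw⟩ := ih
    obtain ⟨c', hc', hp', hw'⟩ := P.exists_chain_of_conj t
    have hcons : seqWord P.codeRel (t :: W) = conjWord P.codeRel t ++ seqWord P.codeRel W :=
      List.flatMap_cons
    refine ⟨c' + c, ?_, fun j => ?_, ?_⟩
    · rw [hcons, decodeWord_append, pathChain_append, hw', mul_one, map_add, hc, hc']
    · rw [map_add, Pi.add_apply, hp, hp', signCount, signCount, List.map_cons, List.sum_cons]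
    · rw [hcons, decodeWord_append, wordValue_append, hw, hw', mul_one]

theorem signCount_mem_sphericalModule {W : List (List (ℕ × Bool) × ℕ × Bool)}
    (hW : FreeGroup.mk (seqWord P.codeRel W) = 1) :
    (fun j : Fin P.n => signCount W j) ∈ P.sphericalModule := by
  obtain ⟨c, hc, hp, -⟩ := P.exists_chain_of_seq W
  refine ⟨c, ?_, funext hp⟩
  have := P.pathChain_eq_of_mk_eq (v := []) ((P.mk_decodeWord_eq_one hW).trans FreeGroup.one_eq_mk) 1
  exact hc.trans this

/-! #### Spherical cycles come from identity sequences -/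

/-- The normal closure of the relators in the free group. -/
abbrev relSubgroup : Subgroup (FreeGroup (Fin P.m)) :=
  Subgroup.normalClosure (Set.range fun i => FreeGroup.mk (P.rel i))

theorem mk_mem_relSubgroup {w : P.Word} :
    FreeGroup.mk w ∈ P.relSubgroup ↔ P.wordValue w = 1 :=
  (QuotientGroup.eq_one_iff _).symm

theorem mk_conj_mem (u v w : P.Word) (h : P.wordValue u * P.wordValue v = P.wordValue w) :
    FreeGroup.mk u * FreeGroup.mk v * (FreeGroup.mk w)⁻¹ ∈ P.relSubgroup := by
  rw [FreeGroup.mul_mk, FreeGroup.inv_mk, FreeGroup.mul_mk, mk_mem_relSubgroup, wordValue_append,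
    wordValue_append, wordValue_invRev, h, mul_inv_cancel]

theorem loop_mem (g : P.Grp) (w : P.Word) :
    FreeGroup.mk (P.wordOf g) * FreeGroup.mk w * (FreeGroup.mk (P.wordOf (g * P.wordValue w)))⁻¹ ∈
      P.relSubgroup :=
  P.mk_conj_mem _ _ _ (by rw [wordValue_wordOf, wordValue_wordOf])

/-- The class in the abelianized relation subgroup of a path in the Cayley graph, closed up along
the chosen representatives of its end points. -/
noncomputable def loopClass (g : P.Grp) (w : P.Word) : Additive (Abelianization P.relSubgroup) :=
  Additive.ofMul (Abelianization.of ⟨_, P.loop_mem g w⟩)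

theorem loopClass_append (g : P.Grp) (u v : P.Word) :
    P.loopClass g (u ++ v) = P.loopClass g u + P.loopClass (g * P.wordValue u) v := by
  rw [loopClass, loopClass, loopClass, ← ofMul_mul, ← map_mul]
  congr 2
  refine Subtype.ext ?_
  simp only [Subgroup.coe_mul, wordValue_append, ← mul_assoc, ← FreeGroup.mul_mk]
  group

/-- The Fox derivatives of a relation determine its class in the abelianized relation subgroup. -/
theorem chainLift_loopClass (g : P.Grp) (w : P.Word) :
    chainLift (fun g x => P.loopClass g [(x, true)]) (P.pathChain g w) = P.loopClass g w := by
  have h0 : ∀ g, P.loopClass g [] = 0 := fun g => by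
    have := P.loopClass_append g [] []
    rw [List.append_nil, wordValue_nil, mul_one] at this
    exact left_eq_add.1 this
  have hcongr : ∀ g {u v : P.Word}, FreeGroup.mk u = FreeGroup.mk v →
      P.loopClass g u = P.loopClass g v := fun g u v h => by
    have hv : P.wordValue u = P.wordValue v := congrArg (PresentedGroup.mk _) h
    rw [loopClass, loopClass]
    congr 2
    exact Subtype.ext (by simp only [h, hv])
  induction w generalizing g with
  | nil => rw [pathChain, map_zero, h0]
  | cons a w ih =>
    have hs := P.loopClass_append g [a] w
    rw [List.singleton_append] at hs
    rcases a with ⟨x, _ | _⟩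
    · rw [pathChain, map_add, ih, map_neg, ← cell, chainLift_cell, hs, wordValue_false]
      congr 1
      rw [neg_eq_iff_add_eq_zero]
      have := P.loopClass_append (g * (PresentedGroup.of x)⁻¹) [(x, true)] [(x, false)]
      rw [wordValue_true, inv_mul_cancel_right, hcongr _ (v := []), h0] at this
      · exact this.symm
      · exact Quot.sound (FreeGroup.Red.Step.not (L₁ := []) (L₂ := []))
    · rw [pathChain, map_add, ih, ← cell, chainLift_cell, hs, wordValue_true]

/-- The path chain collects the Fox derivatives. When it vanishes, so does the class of the loop in
the abelianized relation subgroup. -/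
theorem mk_mem_commutator {w : P.Word} (hw : P.wordValue w = 1) (h : P.pathChain 1 w = 0) :
    FreeGroup.mk w ∈ ⁅P.relSubgroup, P.relSubgroup⁆ := by
  have h1 := P.chainLift_loopClass 1 w
  rw [h, map_zero] at h1
  have h2 : (⟨_, P.loop_mem 1 w⟩ : P.relSubgroup) ∈ commutator P.relSubgroup :=
    (QuotientGroup.eq_one_iff _).1 (Additive.ofMul.injective h1.symm)
  have h3 := Subgroup.mem_map_of_mem P.relSubgroup.subtype h2
  rw [Subgroup.map_subtype_commutator] at h3
  simp only [Subgroup.subtype_apply, one_mul, hw] at h3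
  have hn : (⁅P.relSubgroup, P.relSubgroup⁆).Normal := inferInstance
  -- The representative chosen for `1` need not be the empty word, so the loop is a conjugate of
  -- `w`; normality undoes this.
  have := hn.conj_mem _ h3 (FreeGroup.mk (P.wordOf 1))⁻¹
  have e : ∀ a b : FreeGroup (Fin P.m), a⁻¹ * (a * b * a⁻¹) * a⁻¹⁻¹ = b := fun a b => by group
  rwa [e] at this

/-- An element of the free group is a product of conjugates of relators in which the relators occur
with the multiplicities `v`. -/
def IsSeqProduct (p : FreeGroup (Fin P.m)) (v : Fin P.n → ℤ) : Prop :=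
  ∃ W, FreeGroup.mk (seqWord P.codeRel W) = FreeGroup.map Fin.val p ∧ ∀ j : Fin P.n, signCount W j = v j

variable {P}

theorem IsSeqProduct.one : P.IsSeqProduct 1 0 :=
  ⟨[], by rw [map_one]; rfl, fun _ => rfl⟩

theorem IsSeqProduct.mul {p q : FreeGroup (Fin P.m)} {v w : Fin P.n → ℤ}
    (hp : P.IsSeqProduct p v) (hq : P.IsSeqProduct q w) : P.IsSeqProduct (p * q) (v + w) := by
  obtain ⟨W, hW, hv⟩ := hp
  obtain ⟨W', hW', hv'⟩ := hq
  refine ⟨W ++ W', ?_, fun j => ?_⟩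
  · rw [seqWord, List.flatMap_append, ← FreeGroup.mul_mk, map_mul, ← hW, ← hW']
    rfl
  · rw [signCount, List.map_append, List.sum_append, Pi.add_apply, ← hv, ← hv']
    rfl

theorem IsSeqProduct.inv {p : FreeGroup (Fin P.m)} {v : Fin P.n → ℤ}
    (hp : P.IsSeqProduct p v) : P.IsSeqProduct p⁻¹ (-v) := by
  obtain ⟨W, hW, hv⟩ := hp
  suffices h : ∃ W', FreeGroup.mk (seqWord P.codeRel W') =
      (FreeGroup.mk (seqWord P.codeRel W))⁻¹ ∧ ∀ j : ℕ, signCount W' j = -signCount W j by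
    obtain ⟨W', h1, h2⟩ := h
    exact ⟨W', by rw [h1, hW, map_inv], fun j => by rw [h2, hv, Pi.neg_apply]⟩
  clear hW hv
  induction W with
  | nil => exact ⟨[], by simp [seqWord, ← FreeGroup.one_eq_mk], fun j => by simp [signCount]⟩
  | cons t W ih =>
    obtain ⟨W', h1, h2⟩ := ih
    refine ⟨W' ++ [(t.1, t.2.1, !t.2.2)], ?_, fun j => ?_⟩
    · have e1 : seqWord P.codeRel (t :: W) = conjWord P.codeRel t ++ seqWord P.codeRel W :=
        List.flatMap_cons
      have e2 : seqWord P.codeRel (W' ++ [(t.1, t.2.1, !t.2.2)]) =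
          seqWord P.codeRel W' ++ conjWord P.codeRel (t.1, t.2.1, !t.2.2) := by
        simp [seqWord]
      rw [e1, e2, ← FreeGroup.mul_mk, ← FreeGroup.mul_mk, mul_inv_rev, h1]
      congr 1
      rcases t with ⟨u, i, _ | _⟩ <;>
        simp only [conjWord, Bool.not_false, Bool.not_true, cond_true, cond_false,
          ← FreeGroup.mul_mk, ← FreeGroup.inv_mk] <;> group
    · have := h2 j
      rw [signCount] at this ⊢
      rw [List.map_append, List.sum_append, this, signCount, signCount, List.map_cons,
        List.sum_cons, List.map_nil, List.sum_nil, add_zero, List.map_cons, List.sum_cons,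
        neg_add_rev]
      congr 1
      rcases t with ⟨u, i, _ | _⟩ <;> simp <;> split_ifs <;> simp

theorem mk_codeWord (w : P.Word) :
    FreeGroup.mk (P.codeWord w) = FreeGroup.map Fin.val (FreeGroup.mk w) := rfl

theorem isSeqProduct_conj (u : P.Word) (i : Fin P.n) :
    P.IsSeqProduct (FreeGroup.mk u * FreeGroup.mk (P.rel i) * (FreeGroup.mk u)⁻¹)
      (Pi.single i 1) := by
  refine ⟨[(P.codeWord u, i, true)], ?_, fun j => ?_⟩
  · simp only [seqWord, List.flatMap_singleton, conjWord, cond_true, codeRel_getD,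
      ← FreeGroup.mul_mk, ← FreeGroup.inv_mk, mk_codeWord, map_mul, map_inv, mul_assoc]
  · rw [Pi.single_apply]
    simp only [signCount, List.map_singleton, List.sum_singleton, cond_true]
    exact if_congr ⟨fun h => (Fin.ext h).symm, fun h => by rw [h]⟩ rfl rfl

theorem exists_isSeqProduct {p : FreeGroup (Fin P.m)} (hp : p ∈ P.relSubgroup) :
    ∃ v, P.IsSeqProduct p v := by
  refine Subgroup.closure_induction (p := fun p _ => ∃ v, P.IsSeqProduct p v) ?_ ?_ ?_ ?_ hp
  · intro x hx
    obtain ⟨_, ⟨i, rfl⟩, hc⟩ := Group.mem_conjugatesOfSet_iff.1 hx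
    obtain ⟨g, rfl⟩ := isConj_iff.1 hc
    have := isSeqProduct_conj g.toWord i
    rw [FreeGroup.mk_toWord] at this
    exact ⟨_, this⟩
  · exact ⟨_, IsSeqProduct.one⟩
  · rintro x y - - ⟨v, hv⟩ ⟨w, hw⟩
    exact ⟨_, hv.mul hw⟩
  · rintro x - ⟨v, hv⟩
    exact ⟨_, hv.inv⟩

/-- In a commutator each factor occurs together with its inverse, so the multiplicities cancel. -/
theorem isSeqProduct_of_mem_commutator {p : FreeGroup (Fin P.m)}
    (hp : p ∈ ⁅P.relSubgroup, P.relSubgroup⁆) : P.IsSeqProduct p 0 := by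
  rw [Subgroup.commutator_def] at hp
  refine Subgroup.closure_induction (p := fun p _ => P.IsSeqProduct p 0) ?_ ?_ ?_ ?_ hp
  · rintro _ ⟨a, ha, b, hb, rfl⟩
    obtain ⟨v, hv⟩ := exists_isSeqProduct ha
    obtain ⟨w, hw⟩ := exists_isSeqProduct hb
    have := ((hv.mul hw).mul hv.inv).mul hw.inv
    rwa [show v + w + -v + -w = 0 by abel] at this
  · exact IsSeqProduct.one
  · intro x y _ _ hx hy
    simpa using hx.mul hy
  · intro x _ hx
    simpa using hx.inv

/-- The chains realized by words form a subgroup, and it contains each cell `g · e_i` through the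
conjugate of the relator by a word for `g`. -/
theorem exists_word_of_chain (c : Fin P.n → P.ZG) :
    ∃ w : P.Word, P.IsSeqProduct (FreeGroup.mk w) (P.proj P.n c) ∧
      P.pathChain 1 w = P.d2 c ∧ P.wordValue w = 1 := by
  let S : AddSubgroup (Fin P.n → P.ZG) :=
    { carrier := {c | ∃ w : P.Word, P.IsSeqProduct (FreeGroup.mk w) (P.proj P.n c) ∧
        P.pathChain 1 w = P.d2 c ∧ P.wordValue w = 1}
      zero_mem' := ⟨[], by rw [map_zero]; exact IsSeqProduct.one, by rw [map_zero]; rfl, rfl⟩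
      add_mem' := by
        rintro a b ⟨u, h1, h2, h3⟩ ⟨v, k1, k2, k3⟩
        refine ⟨u ++ v, ?_, ?_, ?_⟩
        · rw [← FreeGroup.mul_mk, map_add]
          exact h1.mul k1
        · rw [pathChain_append, h3, mul_one, h2, k2, map_add]
        · rw [wordValue_append, h3, k3, mul_one]
      neg_mem' := by
        rintro a ⟨u, h1, h2, h3⟩
        refine ⟨FreeGroup.invRev u, ?_, ?_, ?_⟩
        · rw [← FreeGroup.inv_mk, map_neg]
          exact h1.inv
        · rw [pathChain_invRev, h3, inv_one, mul_one, h2, map_neg]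
        · rw [wordValue_invRev, h3, inv_one] }
  have hS : QuotientAddGroup.mk' S = 0 := chain_hom_ext fun g i => by
    rw [AddMonoidHom.zero_apply, QuotientAddGroup.mk'_apply, QuotientAddGroup.eq_zero_iff]
    refine ⟨P.wordOf g ++ P.rel i ++ FreeGroup.invRev (P.wordOf g), ?_, ?_, ?_⟩
    · rw [← FreeGroup.mul_mk, ← FreeGroup.mul_mk, ← FreeGroup.inv_mk, proj_cell]
      exact isSeqProduct_conj _ i
    · simp [pathChain_append, pathChain_invRev, d2_cell, -MonoidAlgebra.of_apply,
        of_smul_pathChain]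
    · simp [wordValue_append, wordValue_invRev]
  exact (QuotientAddGroup.eq_zero_iff (N := S) c).1 (DFunLike.congr_fun hS c)

/-- A word `w` that realizes a 2-cycle has path chain zero, so it lies in the commutator subgroup
and is also a product with all multiplicities zero. Dividing the first expression by the second
gives an identity sequence with counts `v`. -/
theorem exists_identity_seq {v : Fin P.n → ℤ} (hv : v ∈ P.sphericalModule) :
    ∃ W, FreeGroup.mk (seqWord P.codeRel W) = 1 ∧ ∀ j : Fin P.n, signCount W j = v j := by
  obtain ⟨c, hc, rfl⟩ := hv
  obtain ⟨w, h1, h2, h3⟩ := exists_word_of_chain c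
  have hw := isSeqProduct_of_mem_commutator (P.mk_mem_commutator h3 (h2.trans hc))
  have := h1.mul hw.inv
  rw [mul_inv_cancel, neg_zero, add_zero] at this
  obtain ⟨W, hW, hj⟩ := this
  exact ⟨W, by rw [hW, map_one], hj⟩

end FinPresentation

/-! ### Primitive recursive integer arithmetic -/

namespace Primrec

theorem int_ofNat : Primrec (fun n : ℕ => (n : ℤ)) :=
  Primrec.encode_iff.1 (Primrec.nat_double.of_eq fun _ => rfl)

theorem int_negSucc : Primrec Int.negSucc :=
  Primrec.encode_iff.1 (Primrec.nat_double_succ.of_eq fun _ => rfl)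

theorem ofNat_int (n : ℕ) : Denumerable.ofNat ℤ n =
    if n.bodd then Int.negSucc n.div2 else Int.ofNat n.div2 := by
  have h := Nat.bodd_add_div2 n
  cases hb : n.bodd
  · rw [hb] at h
    have hn : n = Encodable.encode (Int.ofNat n.div2) := by
      change n = 2 * n.div2
      simpa using h.symm
    conv_lhs => rw [hn]
    rw [Denumerable.ofNat_encode]
    rfl
  · rw [hb] at h
    have hn : n = Encodable.encode (Int.negSucc n.div2) := by
      change n = 2 * n.div2 + 1
      rw [add_comm]
      simpa using h.symm
    conv_lhs => rw [hn]
    rw [Denumerable.ofNat_encode]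
    rfl

theorem int_toNat : Primrec Int.toNat := by
  refine Primrec.ofNat_iff.2 ((Primrec.cond Primrec.nat_bodd (Primrec.const 0)
    Primrec.nat_div2).of_eq fun n => ?_)
  rw [ofNat_int]
  cases n.bodd <;> rfl

theorem int_toNat_neg : Primrec fun z : ℤ => (-z).toNat := by
  refine Primrec.ofNat_iff.2 ((Primrec.cond Primrec.nat_bodd (Primrec.succ.comp Primrec.nat_div2)
    (Primrec.const 0)).of_eq fun n => ?_)
  rw [ofNat_int]
  cases n.bodd
  · simp
  · rfl

theorem nat_sub_int : Primrec₂ fun a b : ℕ => (a : ℤ) - b := by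
  refine Primrec₂.of_eq (f := fun a b : ℕ => if b ≤ a then ((a - b : ℕ) : ℤ)
    else Int.negSucc (b - a - 1)) ?_ fun a b => ?_
  · have h1 : Primrec fun p : ℕ × ℕ => p.1 - p.2 := Primrec.nat_sub.comp Primrec.fst Primrec.snd
    have h2 : Primrec fun p : ℕ × ℕ => p.2 - p.1 := Primrec.nat_sub.comp Primrec.snd Primrec.fst
    exact Primrec.ite (Primrec.nat_le.comp Primrec.snd Primrec.fst)
      (int_ofNat.comp h1) (int_negSucc.comp (Primrec.pred.comp h2))
  · split_ifs with h
    · omega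
    · rw [Int.negSucc_eq]
      omega

/-- Integer operations reduce to natural ones through `a = a.toNat - (-a).toNat`. -/
theorem int_add : Primrec₂ fun a b : ℤ => a + b := by
  refine Primrec₂.of_eq (f := fun a b : ℤ =>
    ((a.toNat + b.toNat : ℕ) : ℤ) - ((-a).toNat + (-b).toNat : ℕ)) ?_ fun a b => by omega
  exact nat_sub_int.comp
    (Primrec.nat_add.comp (int_toNat.comp Primrec.fst) (int_toNat.comp Primrec.snd))
    (Primrec.nat_add.comp (int_toNat_neg.comp Primrec.fst) (int_toNat_neg.comp Primrec.snd))

theorem int_sub : Primrec₂ fun a b : ℤ => a - b := by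
  refine Primrec₂.of_eq (f := fun a b : ℤ =>
    ((a.toNat + (-b).toNat : ℕ) : ℤ) - ((-a).toNat + b.toNat : ℕ)) ?_ fun a b => by omega
  exact nat_sub_int.comp
    (Primrec.nat_add.comp (int_toNat.comp Primrec.fst) (int_toNat_neg.comp Primrec.snd))
    (Primrec.nat_add.comp (int_toNat_neg.comp Primrec.fst) (int_toNat.comp Primrec.snd))

theorem int_mul : Primrec₂ fun a b : ℤ => a * b := by
  refine Primrec₂.of_eq (f := fun a b : ℤ =>
    ((a.toNat * b.toNat + (-a).toNat * (-b).toNat : ℕ) : ℤ) -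
      (a.toNat * (-b).toNat + (-a).toNat * b.toNat : ℕ)) ?_ fun a b => ?_
  · exact nat_sub_int.comp
      (Primrec.nat_add.comp
        (Primrec.nat_mul.comp (int_toNat.comp Primrec.fst) (int_toNat.comp Primrec.snd))
        (Primrec.nat_mul.comp (int_toNat_neg.comp Primrec.fst) (int_toNat_neg.comp Primrec.snd)))
      (Primrec.nat_add.comp
        (Primrec.nat_mul.comp (int_toNat.comp Primrec.fst) (int_toNat_neg.comp Primrec.snd))
        (Primrec.nat_mul.comp (int_toNat_neg.comp Primrec.fst) (int_toNat.comp Primrec.snd)))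
  · have ha : a = (a.toNat : ℤ) - ((-a).toNat : ℤ) := by omega
    have hb : b = (b.toNat : ℤ) - ((-b).toNat : ℤ) := by omega
    conv_rhs => rw [ha, hb]
    push_cast
    ring

variable {α β : Type*} [Primcodable α] [Primcodable β]

theorem list_sum_int : Primrec (List.sum : List ℤ → ℤ) :=
  (Primrec.list_foldr (h := fun (_ : List ℤ) (p : ℤ × ℤ) => p.1 + p.2) Primrec.id (Primrec.const 0)
    (int_add.comp (Primrec.fst.comp Primrec.snd) (Primrec.snd.comp Primrec.snd)).to₂).of_eq
    fun _ => rfl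

theorem list_sum_map_int {f : α → List β} {g : α → β → ℤ} (hf : Primrec f) (hg : Primrec₂ g) :
    Primrec fun a => ((f a).map (g a)).sum :=
  list_sum_int.comp (Primrec.list_map hf hg)

theorem sum_range_int {f : α → ℕ} {g : α → ℕ → ℤ} (hf : Primrec f) (hg : Primrec₂ g) :
    Primrec fun a => ∑ i ∈ Finset.range (f a), g a i :=
  (list_sum_map_int (Primrec.list_range.comp hf) hg).of_eq fun _ => rfl

theorem freeGroup_invRev : Primrec (FreeGroup.invRev : List (ℕ × Bool) → List (ℕ × Bool)) :=
  Primrec.list_reverse.comp (Primrec.list_map Primrec.id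
    (Primrec.pair (Primrec.fst.comp Primrec.snd)
      (Primrec.not.comp (Primrec.snd.comp Primrec.snd))).to₂)

theorem freeGroup_reduce : Primrec (FreeGroup.reduce : List (ℕ × Bool) → List (ℕ × Bool)) := by
  have hinner : Primrec fun q : (ℕ × Bool) × List (ℕ × Bool) =>
      (List.casesOn q.2 [q.1] fun hd tl =>
        if q.1.1 = hd.1 ∧ q.1.2 = not hd.2 then tl else q.1 :: hd :: tl : List (ℕ × Bool)) := by
    refine Primrec.list_casesOn (h := fun (q : (ℕ × Bool) × List (ℕ × Bool))
      (r : (ℕ × Bool) × List (ℕ × Bool)) =>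
        if q.1.1 = r.1.1 ∧ q.1.2 = not r.1.2 then r.2 else q.1 :: r.1 :: r.2) Primrec.snd
      (Primrec.list_cons.comp Primrec.fst (Primrec.const [])) ?_
    have h1 : Primrec fun p : ((ℕ × Bool) × List (ℕ × Bool)) × ((ℕ × Bool) × List (ℕ × Bool)) =>
      p.1.1 := Primrec.fst.comp Primrec.fst
    have h2 : Primrec fun p : ((ℕ × Bool) × List (ℕ × Bool)) × ((ℕ × Bool) × List (ℕ × Bool)) =>
      p.2.1 := Primrec.fst.comp Primrec.snd
    have h3 : Primrec fun p : ((ℕ × Bool) × List (ℕ × Bool)) × ((ℕ × Bool) × List (ℕ × Bool)) =>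
      p.2.2 := Primrec.snd.comp Primrec.snd
    exact Primrec.ite
      ((Primrec.eq.comp (Primrec.fst.comp h1) (Primrec.fst.comp h2)).and
        (Primrec.eq.comp (Primrec.snd.comp h1) (Primrec.not.comp (Primrec.snd.comp h2))))
      h3 (Primrec.list_cons.comp h1 (Primrec.list_cons.comp h2 h3))
  refine (Primrec.list_foldr (h := fun (_ : List (ℕ × Bool))
    (q : (ℕ × Bool) × List (ℕ × Bool)) =>
      (List.casesOn q.2 [q.1] fun hd tl =>
        if q.1.1 = hd.1 ∧ q.1.2 = not hd.2 then tl else q.1 :: hd :: tl : List (ℕ × Bool)))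
    Primrec.id (Primrec.const []) (hinner.comp Primrec.snd).to₂).of_eq fun L => ?_
  induction L with
  | nil => rfl
  | cons x L ih =>
    rw [FreeGroup.reduce.cons, ← ih]
    rfl

end Primrec

theorem PrimrecPred.forall_lt_of {α : Type*} [Primcodable α] {f : α → ℕ} {R : ℕ → α → Prop}
    (hf : Primrec f) (hR : PrimrecPred fun p : ℕ × α => R p.1 p.2) :
    PrimrecPred fun a => ∀ i < f a, R i a :=
  ((PrimrecRel.forall_mem_list (R := R) hR).comp (Primrec.list_range.comp hf) Primrec.id).of_eq
    fun a => by simp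

/-- An unbounded search for certificates. -/
theorem exists_partrec_search {α γ σ : Type*} [Primcodable α] [Primcodable γ] [Primcodable σ]
    {R : α → γ → Prop} (hR : PrimrecRel R) {out : α → γ → σ} (hout : Primrec₂ out) :
    ∃ f : α →. σ, Partrec f ∧ ∀ a, (∃ c, R a c) → ∃ c, R a c ∧ out a c ∈ f a := by
  classical
  let g : α → ℕ → Option σ := fun a n =>
    (Encodable.decode (α := γ) n).bind fun c => if R a c then some (out a c) else none
  have hg : Primrec₂ g := by
    refine Primrec.option_bind (Primrec.decode.comp Primrec.snd) ?_
    have hpair : Primrec fun p : (α × ℕ) × γ => (p.1.1, p.2) :=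
      Primrec.pair (Primrec.fst.comp Primrec.fst) Primrec.snd
    exact Primrec.ite (PrimrecPred.comp hR hpair)
      (Primrec.option_some.comp (Primrec.comp hout hpair)) (Primrec.const none)
  refine ⟨fun a => Nat.rfindOpt (g a), Partrec.rfindOpt hg.to_comp, fun a ⟨c, hc⟩ => ?_⟩
  have hdom : (Nat.rfindOpt (g a)).Dom :=
    Nat.rfindOpt_dom.2 ⟨Encodable.encode c, out a c, by simp [g, hc]⟩
  obtain ⟨n, hn⟩ := Nat.rfindOpt_spec (Part.get_mem hdom)
  obtain ⟨c', -, hc'⟩ := Option.bind_eq_some_iff.1 hn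
  by_cases h : R a c'
  · rw [if_pos h] at hc'
    refine ⟨c', h, ?_⟩
    rw [Option.some.inj hc']
    exact Part.get_mem hdom
  · rw [if_neg h] at hc'
    exact absurd hc' (by simp)

namespace FinPresentation

/-! ### Certificates -/

/-- The entry of a matrix given as a list of rows. -/
def entry (A : List (List ℤ)) (i j : ℕ) : ℤ := (A.getD i []).getD j 0

/-- The exponent sum of a generator in a word. -/
def expCount (w : List (ℕ × Bool)) (j : ℕ) : ℤ :=
  (w.map fun a => if a.1 = j then cond a.2 1 (-1) else 0).sum

/-- The rank of the kernel of the augmented idempotent. -/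
def sphericalRank (x : Input) : ℕ :=
  ((x.1.2.length : ℤ) - ∑ i ∈ Finset.range x.1.2.length,
    (((x.2.getD i []).getD i []).map fun t => t.1).sum).toNat

/-- Certificates: the first component consists of a matrix `N` and of auxiliary matrices `B`, `D`,
the second of a denominator and of the rank of `H₂(G)`, the third of identity sequences. -/
abbrev Certificate : Type :=
  (List (List ℤ) × List (List ℤ) × List (List ℤ)) × (ℤ × ℕ) ×
    List (List (List (ℕ × Bool) × ℕ × Bool))

/-- A certificate is valid if the rows of `N` are a basis of `H₂(K)` that starts with a basis of
the group of spherical cycles. -/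
def Valid (x : Input) (c : Certificate) : Prop :=
  (∀ i < sphericalRank x, FreeGroup.reduce (seqWord x.1.2 (c.2.2.getD i [])) = [] ∧
    ∀ j < x.1.2.length, entry c.1.1 i j = signCount (c.2.2.getD i []) j) ∧
  (∀ i < sphericalRank x + c.2.1.2, ∀ j < sphericalRank x + c.2.1.2,
    ∑ l ∈ Finset.range x.1.2.length, entry c.1.1 i l * entry c.1.2.1 l j =
      if i = j then 1 else 0) ∧
  (∀ i < sphericalRank x + c.2.1.2, ∀ j < x.1.1,
    ∑ l ∈ Finset.range x.1.2.length, entry c.1.1 i l * expCount (x.1.2.getD l []) j = 0) ∧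
  c.2.1.1 ≠ 0 ∧
  ∀ i < x.1.2.length, ∀ j < x.1.2.length,
    c.2.1.1 * ((if i = j then 1 else 0) -
      ∑ l ∈ Finset.range (sphericalRank x + c.2.1.2), entry c.1.2.1 i l * entry c.1.1 l j) =
    ∑ l ∈ Finset.range x.1.1, expCount (x.1.2.getD i []) l * entry c.1.2.2 l j

section

open Primrec

variable {α : Type*} [Primcodable α]

theorem primrec_entry {f : α → List (List ℤ)} {g h : α → ℕ} (hf : Primrec f) (hg : Primrec g)
    (hh : Primrec h) : Primrec fun a => entry (f a) (g a) (h a) :=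
  (list_getD 0).comp ((list_getD []).comp hf hg) hh

theorem primrec_expCount {f : α → List (ℕ × Bool)} {g : α → ℕ} (hf : Primrec f) (hg : Primrec g) :
    Primrec fun a => expCount (f a) (g a) :=
  list_sum_map_int hf (Primrec.ite (Primrec.eq.comp (fst.comp snd) (hg.comp fst))
    (Primrec.cond (snd.comp snd) (const 1) (const (-1))) (const 0)).to₂

theorem primrec_signCount {f : α → List (List (ℕ × Bool) × ℕ × Bool)} {g : α → ℕ}
    (hf : Primrec f) (hg : Primrec g) : Primrec fun a => signCount (f a) (g a) :=
  list_sum_map_int hf (Primrec.ite (Primrec.eq.comp (fst.comp (snd.comp snd)) (hg.comp fst))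
    (Primrec.cond (snd.comp (snd.comp snd)) (const 1) (const (-1))) (const 0)).to₂

theorem primrec_seqWord {f : α → List (List (ℕ × Bool))}
    {g : α → List (List (ℕ × Bool) × ℕ × Bool)} (hf : Primrec f) (hg : Primrec g) :
    Primrec fun a => seqWord (f a) (g a) := by
  refine list_flatMap hg ?_
  have hr : Primrec fun p : α × (List (ℕ × Bool) × ℕ × Bool) => (f p.1).getD p.2.2.1 [] :=
    (list_getD []).comp (hf.comp fst) (fst.comp (snd.comp snd))
  exact list_append.comp (fst.comp snd) (list_append.comp
    (Primrec.cond (snd.comp (snd.comp snd)) hr (freeGroup_invRev.comp hr))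
    (freeGroup_invRev.comp (fst.comp snd)))

theorem primrec_sphericalRank : Primrec sphericalRank := by
  have hn : Primrec fun x : Input => x.1.2.length := list_length.comp (snd.comp fst)
  refine int_toNat.comp (int_sub.comp (int_ofNat.comp hn) (sum_range_int hn ?_))
  exact list_sum_map_int ((list_getD []).comp ((list_getD []).comp (snd.comp fst) snd) snd)
    (fst.comp snd).to₂

theorem primrecRel_valid : PrimrecRel Valid := by
  have hx : Primrec fun p : Input × Certificate => p.1 := fst
  have hn : Primrec fun p : Input × Certificate => p.1.1.2.length :=
    list_length.comp (snd.comp (fst.comp hx))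
  have hR : Primrec fun p : Input × Certificate => p.1.1.2 := snd.comp (fst.comp hx)
  have hm : Primrec fun p : Input × Certificate => p.1.1.1 := fst.comp (fst.comp hx)
  have hs : Primrec fun p : Input × Certificate => sphericalRank p.1 :=
    primrec_sphericalRank.comp hx
  have hN : Primrec fun p : Input × Certificate => p.2.1.1 := fst.comp (fst.comp snd)
  have hB : Primrec fun p : Input × Certificate => p.2.1.2.1 := fst.comp (snd.comp (fst.comp snd))
  have hD : Primrec fun p : Input × Certificate => p.2.1.2.2 := snd.comp (snd.comp (fst.comp snd))
  have hd : Primrec fun p : Input × Certificate => p.2.2.1.1 := fst.comp (fst.comp (snd.comp snd))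
  have hk : Primrec fun p : Input × Certificate => p.2.2.1.2 := snd.comp (fst.comp (snd.comp snd))
  have hW : Primrec fun p : Input × Certificate => p.2.2.2 := snd.comp (snd.comp snd)
  have hr := nat_add.comp hs hk
  have hi : Primrec fun q : ℕ × ℕ × Input × Certificate => q.2.1 := fst.comp snd
  have hj : Primrec fun q : ℕ × ℕ × Input × Certificate => q.1 := fst
  have hp : Primrec fun q : ℕ × ℕ × Input × Certificate => q.2.2 := snd.comp snd
  have hi' : Primrec fun q : (ℕ × ℕ × Input × Certificate) × ℕ => q.1.2.1 := hi.comp fst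
  have hj' : Primrec fun q : (ℕ × ℕ × Input × Certificate) × ℕ => q.1.1 := hj.comp fst
  have hp' : Primrec fun q : (ℕ × ℕ × Input × Certificate) × ℕ => q.1.2.2 := hp.comp fst
  refine PrimrecPred.and ?_ (PrimrecPred.and ?_ (PrimrecPred.and ?_ (PrimrecPred.and ?_ ?_)))
  · refine PrimrecPred.forall_lt_of hs (PrimrecPred.and ?_ (PrimrecPred.forall_lt_of (hn.comp snd) ?_))
    · exact Primrec.eq.comp (freeGroup_reduce.comp (primrec_seqWord (hR.comp snd)
        ((list_getD []).comp (hW.comp snd) fst))) (const [])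
    · exact Primrec.eq.comp (primrec_entry (hN.comp hp) hi hj)
        (primrec_signCount ((list_getD []).comp (hW.comp hp) hi) hj)
  · refine PrimrecPred.forall_lt_of hr (PrimrecPred.forall_lt_of (hr.comp snd) ?_)
    exact Primrec.eq.comp (sum_range_int (hn.comp hp) (int_mul.comp
        (primrec_entry (hN.comp hp') hi' snd) (primrec_entry (hB.comp hp') snd hj')))
      (Primrec.ite (Primrec.eq.comp hi hj) (const 1) (const 0))
  · refine PrimrecPred.forall_lt_of hr (PrimrecPred.forall_lt_of (hm.comp snd) ?_)
    exact Primrec.eq.comp (sum_range_int (hn.comp hp) (int_mul.comp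
        (primrec_entry (hN.comp hp') hi' snd)
        (primrec_expCount ((list_getD []).comp (hR.comp hp') snd) hj'))) (const 0)
  · exact (Primrec.eq.comp hd (const 0)).not
  · refine PrimrecPred.forall_lt_of hn (PrimrecPred.forall_lt_of (hn.comp snd) ?_)
    refine Primrec.eq.comp (int_mul.comp (hd.comp hp) (int_sub.comp
        (Primrec.ite (Primrec.eq.comp hi hj) (const 1) (const 0))
        (sum_range_int (hr.comp hp) (int_mul.comp
          (primrec_entry (hB.comp hp') hi' snd) (primrec_entry (hN.comp hp') snd hj')))))
      (sum_range_int (hm.comp hp) (int_mul.comp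
        (primrec_expCount ((list_getD []).comp (hR.comp hp') hi') snd)
        (primrec_entry (hD.comp hp') snd hj')))

/-- The matrix with `r` rows of length `n` whose first row is the row of `A` with index `s`. -/
def rowsFrom (A : List (List ℤ)) (s r n : ℕ) : List (List ℤ) :=
  (List.range r).map fun i => (List.range n).map fun j => entry A (s + i) j

theorem primrec_rowsFrom {A : α → List (List ℤ)} {s r n : α → ℕ} (hA : Primrec A)
    (hs : Primrec s) (hr : Primrec r) (hn : Primrec n) :
    Primrec fun a => rowsFrom (A a) (s a) (r a) (n a) := by
  refine list_map (list_range.comp hr) (list_map (list_range.comp (hn.comp fst)) ?_)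
  exact primrec_entry (hA.comp (fst.comp fst))
    (nat_add.comp (hs.comp (fst.comp fst)) (snd.comp fst)) snd

end

end FinPresentation

/-! ### Linear algebra over the integers -/

/-- Up to a denominator, a linear map on a submodule of a free module extends to the module. -/
theorem exists_extend_smul {ι M : Type*} [Fintype ι] [AddCommGroup M] (L : Submodule ℤ (ι → ℤ))
    (σ : L →ₗ[ℤ] M) : ∃ (d : ℤ) (D : (ι → ℤ) →ₗ[ℤ] M), d ≠ 0 ∧ ∀ y : L, D y = d • σ y := by
  obtain ⟨n, snf⟩ := Submodule.smithNormalForm (Pi.basisFun ℤ ι) L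
  have ha : ∀ i, snf.a i ≠ 0 := fun i h => by
    have h0 : (snf.bN i : ι → ℤ) = 0 := by rw [snf.snf, h, zero_smul]
    exact snf.bN.ne_zero i (Subtype.ext h0)
  let D : (ι → ℤ) →ₗ[ℤ] M := snf.bM.constr ℤ
    -- In a Smith basis the generators of `L` are `a i` times basis vectors. Multiplying `σ` by the
    -- product of the other factors gives the common denominator `∏ a i`; the remaining basis
    -- vectors go to zero.
    (Function.extend snf.f (fun i => (∏ j ∈ Finset.univ.erase i, snf.a j) • σ (snf.bN i)) 0)
  refine ⟨∏ i, snf.a i, D, Finset.prod_ne_zero_iff.2 fun i _ => ha i, fun y => ?_⟩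
  have : D ∘ₗ L.subtype = (∏ i, snf.a i) • σ := snf.bN.ext fun i => by
    rw [LinearMap.comp_apply, Submodule.subtype_apply, snf.snf, map_smul, Module.Basis.constr_basis,
      snf.f.injective.extend_apply, smul_smul, LinearMap.smul_apply,
      Finset.mul_prod_erase _ _ (Finset.mem_univ i)]
  exact LinearMap.congr_fun this y

/-- If the kernel of a surjection is spanned by the first part of a basis, then the images of the
remaining part form a basis. -/
theorem linearIndependent_and_span_of_ker {R H Q ι κ : Type*} [Ring R] [AddCommGroup H]
    [AddCommGroup Q] [Module R H] [Module R Q] (φ : H →ₗ[R] Q) (hφ : Function.Surjective φ)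
    (v : ι ⊕ κ → H) (hv : LinearIndependent R v) (hspan : Submodule.span R (Set.range v) = ⊤)
    (hker : LinearMap.ker φ = Submodule.span R (Set.range fun i => v (Sum.inl i))) :
    LinearIndependent R (fun j => φ (v (Sum.inr j))) ∧
      Submodule.span R (Set.range fun j => φ (v (Sum.inr j))) = ⊤ := by
  obtain ⟨-, h2, h3⟩ := linearIndependent_sum.1 hv
  constructor
  · refine h2.map (f := φ) ?_
    rw [hker, disjoint_comm]
    exact h3
  · rw [eq_top_iff, ← LinearMap.range_eq_top.2 hφ, LinearMap.range_eq_map, ← hspan,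
      Submodule.map_span, Submodule.span_le]
    rintro _ ⟨_, ⟨i | j, rfl⟩, rfl⟩
    · have : v (Sum.inl i) ∈ LinearMap.ker φ := by
        rw [hker]
        exact Submodule.subset_span ⟨i, rfl⟩
      rw [LinearMap.mem_ker.1 this]
      exact zero_mem _
    · exact Submodule.subset_span ⟨j, rfl⟩

/-! ### Matrix certificates for bases of `H₂(K)` -/

namespace FinPresentation

variable (P : FinPresentation)

/-- The matrix of the boundary `C₂(K) → C₁(K)`. -/
def relMatrix : Matrix (Fin P.n) (Fin P.m) ℤ := Matrix.of fun i => P.expSum (P.rel i)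

theorem dK2_eq_vecMul (v : Fin P.n → ℤ) : P.dK2 v = Matrix.vecMul v P.relMatrix := by
  rw [dK2, Fintype.linearCombination_apply]
  funext j
  rw [Matrix.vecMul, dotProduct, Finset.sum_apply]
  rfl

/-- The rows of `N` form a basis of `H₂(K)`, as is witnessed by `B`, `D` and `d`. -/
structure IsBasisMatrix {r : ℕ} (N : Matrix (Fin r) (Fin P.n) ℤ) (B : Matrix (Fin P.n) (Fin r) ℤ)
    (D : Matrix (Fin P.m) (Fin P.n) ℤ) (d : ℤ) : Prop where
  mul_eq_one : N * B = 1
  mul_relMatrix : N * P.relMatrix = 0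
  ne_zero : d ≠ 0
  smul_eq : d • (1 - B * N) = P.relMatrix * D

variable {P}

namespace IsBasisMatrix

variable {r : ℕ} {N : Matrix (Fin r) (Fin P.n) ℤ} {B : Matrix (Fin P.n) (Fin r) ℤ}
  {D : Matrix (Fin P.m) (Fin P.n) ℤ} {d : ℤ} (h : P.IsBasisMatrix N B D d)

include h

theorem mem_H2 (i : Fin r) : N i ∈ P.H2 := by
  rw [LinearMap.mem_ker, dK2_eq_vecMul]
  have := congrFun h.mul_relMatrix i
  rwa [Matrix.mul_apply_eq_vecMul] at this

/-- The basis of `H₂(K)`. -/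
def vec (i : Fin r) : P.H2 := ⟨N i, h.mem_H2 i⟩

/-- A cycle is killed by the boundary matrix, hence by `d • (1 - B * N)`, and `d` can be cancelled.
-/
theorem vecMul_eq {v : Fin P.n → ℤ} (hv : v ∈ P.H2) : Matrix.vecMul (Matrix.vecMul v B) N = v := by
  rw [LinearMap.mem_ker, dK2_eq_vecMul] at hv
  have h1 : Matrix.vecMul v (d • (1 - B * N)) = 0 := by
    rw [h.smul_eq, ← Matrix.vecMul_vecMul, hv, Matrix.zero_vecMul]
  rw [Matrix.vecMul_smul, smul_eq_zero, or_iff_right h.ne_zero, Matrix.vecMul_sub,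
    Matrix.vecMul_one, ← Matrix.vecMul_vecMul, sub_eq_zero] at h1
  exact h1.symm

theorem coe_sum (a : Fin r → ℤ) :
    ((∑ i, a i • h.vec i : P.H2) : Fin P.n → ℤ) = Matrix.vecMul a N := by
  rw [Submodule.coe_sum]
  funext j
  rw [Finset.sum_apply, Matrix.vecMul, dotProduct]
  rfl

theorem linearIndependent : LinearIndependent ℤ h.vec := by
  rw [Fintype.linearIndependent_iff]
  intro a ha i
  have h1 : Matrix.vecMul a N = 0 := by rw [← h.coe_sum, ha]; rfl
  have h2 : Matrix.vecMul (Matrix.vecMul a N) B = a := by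
    rw [Matrix.vecMul_vecMul, h.mul_eq_one, Matrix.vecMul_one]
  rw [← h2, h1, Matrix.zero_vecMul]
  rfl

theorem span_eq_top : Submodule.span ℤ (Set.range h.vec) = ⊤ := by
  rw [eq_top_iff]
  intro v _
  rw [Submodule.mem_span_range_iff_exists_fun]
  exact ⟨Matrix.vecMul (v : Fin P.n → ℤ) B, Subtype.ext (by rw [h.coe_sum, h.vecMul_eq v.2])⟩

end IsBasisMatrix

/-- A family of spherical cycles, of the right size, that has a left inverse spans. -/
theorem span_eq_sigma {s : ℕ} (hs : Module.finrank ℤ P.sphericalModule = s) (v : Fin s → P.H2)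
    (hv : ∀ i, (v i : Fin P.n → ℤ) ∈ P.sphericalModule)
    (κ : (Fin P.n → ℤ) →ₗ[ℤ] (Fin s → ℤ)) (hκ : ∀ i, κ (v i) = Pi.single i 1) :
    Submodule.span ℤ (Set.range v) = P.sigma := by
  refine le_antisymm (Submodule.span_le.2 ?_) fun w hw => ?_
  · rintro _ ⟨i, rfl⟩
    exact P.mem_sigma_iff.2 (hv i)
  · let e := (Module.finBasisOfFinrankEq ℤ P.sphericalModule hs).equivFun
    let κ' : P.sphericalModule →ₗ[ℤ] (Fin s → ℤ) := κ ∘ₗ P.sphericalModule.subtype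
    have hcomb : ∀ a : Fin s → ℤ, κ (∑ i, a i • v i : P.H2) = a := fun a => by
      rw [Submodule.coe_sum, map_sum]
      conv_rhs => rw [pi_eq_sum_univ' a]
      refine Finset.sum_congr rfl fun i _ => ?_
      rw [Submodule.coe_smul, map_smul, hκ]
    have hmem : ∀ a : Fin s → ℤ, ((∑ i, a i • v i : P.H2) : Fin P.n → ℤ) ∈ P.sphericalModule :=
      fun a => by
        rw [Submodule.coe_sum]
        exact Submodule.sum_mem _ fun i _ => Submodule.smul_mem _ _ (hv i)
    have hsurj : Function.Surjective (κ' ∘ₗ e.symm.toLinearMap) := fun a =>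
      ⟨e ⟨_, hmem a⟩, by
        change κ' (e.symm (e _)) = a
        rw [LinearEquiv.symm_apply_apply]
        exact hcomb a⟩
    -- A surjective endomorphism of `ℤˢ` is injective, so `κ` separates spherical cycles. Since `w`
    -- and the combination of the `v i` with coefficients `κ w` have the same image, they agree.
    have hinj := OrzechProperty.injective_of_surjective_endomorphism _ hsurj
    have hinj' : Function.Injective κ' := by
      intro x y hxy
      refine e.injective (hinj ?_)
      change κ' (e.symm (e x)) = κ' (e.symm (e y))
      rw [LinearEquiv.symm_apply_apply, LinearEquiv.symm_apply_apply, hxy]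
    have hw' := P.mem_sigma_iff.1 hw
    have := @hinj' ⟨_, hmem (κ w)⟩ ⟨w, hw'⟩ (hcomb (κ w))
    rw [Submodule.mem_span_range_iff_exists_fun]
    exact ⟨κ w, Subtype.ext (Subtype.mk.inj this)⟩

/-- Join bases of `Σ_K` and of a complement to form `N`. `B` takes coordinates after a projection of
`ℤⁿ` onto `H₂(K)`, which exists because the image of `dK2` is free. -/
theorem exists_isBasisMatrix (hcd : P.HasCdTwo) :
    ∃ (k : ℕ) (N : Matrix (Fin (Module.finrank ℤ P.sphericalModule + k)) (Fin P.n) ℤ)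
      (B : Matrix (Fin P.n) (Fin (Module.finrank ℤ P.sphericalModule + k)) ℤ)
      (D : Matrix (Fin P.m) (Fin P.n) ℤ) (d : ℤ), P.IsBasisMatrix N B D d ∧
      ∀ i : Fin (Module.finrank ℤ P.sphericalModule), N (Fin.castAdd k i) ∈ P.sphericalModule := by
  obtain ⟨T, hT⟩ := P.exists_isCompl_sigma hcd
  have hfin : Module.finrank ℤ P.sigma = Module.finrank ℤ P.sphericalModule := by
    rw [← P.map_sigma]
    exact (Submodule.equivMapOfInjective _ P.H2.injective_subtype P.sigma).finrank_eq
  let b : Module.Basis (Fin (Module.finrank ℤ P.sphericalModule + Module.finrank ℤ T)) ℤ P.H2 :=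
    (((Module.finBasisOfFinrankEq ℤ P.sigma hfin).prod (Module.finBasis ℤ T)).map
      (Submodule.prodEquivOfIsCompl _ _ hT)).reindex finSumFinEquiv
  have hb : ∀ i, b (Fin.castAdd _ i) = Module.finBasisOfFinrankEq ℤ P.sigma hfin i := fun i => by
    have : finSumFinEquiv.symm (Fin.castAdd (Module.finrank ℤ T) i) = Sum.inl i :=
      finSumFinEquiv_symm_apply_castAdd i
    rw [Module.Basis.reindex_apply, this]
    simp
  obtain ⟨σ, hσ⟩ := Module.projective_lifting_property P.dK2.rangeRestrict LinearMap.id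
    P.dK2.surjective_rangeRestrict
  have hσ' : ∀ y, P.dK2 (σ y) = y := fun y => congrArg Subtype.val (LinearMap.congr_fun hσ y)
  let π : (Fin P.n → ℤ) →ₗ[ℤ] P.H2 :=
    (LinearMap.id - σ ∘ₗ P.dK2.rangeRestrict).codRestrict P.H2 fun v => by
      change P.dK2 (v - σ (P.dK2.rangeRestrict v)) = 0
      rw [map_sub, hσ']
      exact sub_self _
  have hπ : ∀ v, ((π v : P.H2) : Fin P.n → ℤ) = v - σ (P.dK2.rangeRestrict v) := fun v => rfl
  have hπ' : ∀ v : P.H2, π v = v := fun v => Subtype.ext (by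
    have : P.dK2.rangeRestrict v = 0 := Subtype.ext v.2
    rw [hπ, this, map_zero, sub_zero])
  -- The image of `dK2` need not be a direct summand of `ℤᵐ`, so its section `σ` extends only up to
  -- a denominator.
  obtain ⟨d, D, hd, hD⟩ := exists_extend_smul _ σ
  let N : Matrix (Fin (Module.finrank ℤ P.sphericalModule + Module.finrank ℤ T)) (Fin P.n) ℤ :=
    Matrix.of fun i => (b i : Fin P.n → ℤ)
  let B : Matrix (Fin P.n) (Fin (Module.finrank ℤ P.sphericalModule + Module.finrank ℤ T)) ℤ :=
    (LinearMap.toMatrix' (b.equivFun.toLinearMap ∘ₗ π)).transpose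
  have hB : ∀ v, Matrix.vecMul v B = b.equivFun (π v) := fun v => by
    rw [Matrix.vecMul_transpose, LinearMap.toMatrix'_mulVec]
    rfl
  have hN : ∀ v : P.H2, Matrix.vecMul (b.equivFun v) N = v := fun v => by
    conv_rhs => rw [← b.sum_equivFun v]
    rw [Submodule.coe_sum]
    funext j
    rw [Finset.sum_apply, Matrix.vecMul, dotProduct]
    rfl
  refine ⟨_, N, B, (LinearMap.toMatrix' D).transpose, d, ⟨?_, ?_, hd, ?_⟩, fun i => ?_⟩
  · funext i
    rw [Matrix.mul_apply_eq_vecMul]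
    change Matrix.vecMul (b i : Fin P.n → ℤ) B = _
    funext j
    rw [hB, hπ', Module.Basis.equivFun_self, Matrix.one_apply]
  · funext i
    rw [Matrix.mul_apply_eq_vecMul, ← dK2_eq_vecMul]
    exact (b i).2
  -- On row vectors, `1 - B * N` is `1 - π = σ ∘ dK2`, and `D` restricts to `d • σ`.
  · refine Matrix.ext_of_single_vecMul fun i => ?_
    rw [Matrix.vecMul_smul, Matrix.vecMul_sub, Matrix.vecMul_one, ← Matrix.vecMul_vecMul, hB, hN, hπ,
      sub_sub_cancel, ← Matrix.vecMul_vecMul, Matrix.vecMul_transpose, LinearMap.toMatrix'_mulVec,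
      ← dK2_eq_vecMul]
    exact (hD _).symm
  · change ((b (Fin.castAdd _ i) : P.H2) : Fin P.n → ℤ) ∈ _
    rw [hb]
    exact P.mem_sigma_iff.1 (Subtype.mem _)

end FinPresentation

namespace FinPresentation

variable {P : FinPresentation}

/-! ### Validity of certificates for coded inputs -/

theorem expCount_codeWord (w : P.Word) (j : Fin P.m) : expCount (P.codeWord w) j = P.expSum w j := by
  induction w with
  | nil => rfl
  | cons a w ih =>
    have hcons : expCount (P.codeWord (a :: w)) j =
        (if (a.1 : ℕ) = j then cond a.2 1 (-1) else 0) + expCount (P.codeWord w) j := rfl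
    have hij : ∀ x : Fin P.m, ((x : ℕ) = j) ↔ j = x := fun x =>
      ⟨fun h => (Fin.ext h).symm, fun h => by rw [h]⟩
    rcases a with ⟨x, _ | _⟩
    · rw [hcons, ih, expSum, Pi.add_apply, Pi.neg_apply, Pi.single_apply]
      simp only [hij, cond_false]
      split_ifs <;> rfl
    · rw [hcons, ih, expSum, Pi.add_apply, Pi.single_apply]
      simp only [hij, cond_true]

theorem expCount_codeRel (i : Fin P.n) (j : Fin P.m) :
    expCount (P.codeRel.getD i []) j = P.relMatrix i j := by
  rw [codeRel_getD, expCount_codeWord]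
  rfl

theorem length_codeRel : P.codeRel.length = P.n := List.length_ofFn

theorem aug_formalSumValue (s : P.FormalSum) :
    P.aug (P.formalSumValue s) = (s.map fun t => t.1).sum := by
  rw [formalSumValue, map_list_sum, List.map_map]
  refine congrArg List.sum (List.map_congr_left fun t _ => ?_)
  rw [Function.comp_apply, map_zsmul, aug_of, smul_eq_mul, mul_one]

/-- Augmentation only sums coefficients, so the trace does not depend on which words are equal in
`G`. Truncation by `toNat` is harmless, as the value is a rank. -/
theorem sphericalRank_code {M : P.FormalMatrix} (hM : P.Admissible M) :
    sphericalRank (P.code M) = Module.finrank ℤ P.sphericalModule := by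
  have h := P.finrank_sphericalModule hM.cd_two hM.idempotent hM.image_iso.some hM.kernel_iso.some
  have hn : (P.code M).1.2.length = P.n := length_codeRel
  have ht : ∑ i ∈ Finset.range P.n,
      ((((P.code M).2.getD i []).getD i []).map fun t => t.1).sum =
      ∑ i, P.aug (P.matrixValue M i i) := by
    rw [Finset.sum_range]
    refine Finset.sum_congr rfl fun i _ => ?_
    rw [matrixValue, Matrix.of_apply, aug_formalSumValue]
    simp [code, List.getD_eq_getElem?_getD, Function.comp_def]
  rw [sphericalRank, hn, ht]
  omega

theorem entry_ofFn {a b : ℕ} (A : Matrix (Fin a) (Fin b) ℤ) (i : Fin a) (j : Fin b) :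
    entry (List.ofFn fun i => List.ofFn (A i)) i j = A i j := by
  simp [entry, List.getD_eq_getElem?_getD]

/-- The matrix with prescribed size and entries. -/
def listMatrix (a b : ℕ) (A : List (List ℤ)) : Matrix (Fin a) (Fin b) ℤ :=
  Matrix.of fun i j => entry A i j

theorem listMatrix_ofFn {a b : ℕ} (A : Matrix (Fin a) (Fin b) ℤ) :
    listMatrix a b (List.ofFn fun i => List.ofFn (A i)) = A :=
  Matrix.ext fun i j => entry_ofFn A i j

theorem valid_code_iff {M : P.FormalMatrix} (c : Certificate) :
    Valid (P.code M) c ↔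
      (∀ i < sphericalRank (P.code M),
        FreeGroup.mk (seqWord P.codeRel (c.2.2.getD i [])) = 1 ∧
        ∀ j : Fin P.n, entry c.1.1 i j = signCount (c.2.2.getD i []) j) ∧
      P.IsBasisMatrix (listMatrix (sphericalRank (P.code M) + c.2.1.2) P.n c.1.1)
        (listMatrix P.n (sphericalRank (P.code M) + c.2.1.2) c.1.2.1)
        (listMatrix P.m P.n c.1.2.2) c.2.1.1 := by
  have hn : (P.code M).1.2.length = P.n := length_codeRel
  have hm : (P.code M).1.1 = P.m := rfl
  have hR : (P.code M).1.2 = P.codeRel := rfl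
  have hred : ∀ w : List (ℕ × Bool), FreeGroup.reduce w = [] ↔ FreeGroup.mk w = 1 := fun w => by
    rw [← FreeGroup.toWord_mk, FreeGroup.toWord_eq_nil_iff]
  have h1 : ∀ {a : ℕ} {p : ℕ → Prop}, (∀ i < a, p i) ↔ ∀ i : Fin a, p i :=
    ⟨fun h i => h i i.2, fun h i hi => h ⟨i, hi⟩⟩
  rw [Valid, hn, hm, hR]
  refine and_congr ?_ ?_
  · simp only [hred, h1 (a := P.n)]
  · simp only [h1, Finset.sum_range, expCount_codeRel]
    constructor
    · rintro ⟨k1, k2, k3, k4⟩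
      refine ⟨Matrix.ext fun i j => ?_, Matrix.ext fun i j => k2 i j, k3, Matrix.ext fun i j => ?_⟩
      · rw [Matrix.one_apply, Matrix.mul_apply]
        exact (k1 i j).trans (if_congr Fin.val_inj rfl rfl)
      · have := k4 i j
        rw [if_congr Fin.val_inj rfl rfl] at this
        rw [Matrix.smul_apply, Matrix.sub_apply, Matrix.one_apply, Matrix.mul_apply,
          Matrix.mul_apply]
        exact this
    · rintro ⟨k1, k2, k3, k4⟩
      refine ⟨fun i j => ?_, fun i j => congrFun (congrFun k2 i) j, k3, fun i j => ?_⟩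
      · have := congrFun (congrFun k1 i) j
        rw [Matrix.one_apply, Matrix.mul_apply] at this
        exact this.trans (if_congr Fin.val_inj.symm rfl rfl)
      · have := congrFun (congrFun k4 i) j
        rw [Matrix.smul_apply, Matrix.sub_apply, Matrix.one_apply, Matrix.mul_apply,
          Matrix.mul_apply] at this
        rw [if_congr Fin.val_inj rfl rfl]
        exact this

/-- This makes the search halt: the matrices come from the splitting of `H₂(K)`, the sequences from
the sphericity of the first rows. -/
theorem exists_valid {M : P.FormalMatrix} (hM : P.Admissible M) : ∃ c, Valid (P.code M) c := by
  have h := exists_isBasisMatrix hM.cd_two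
  rw [← sphericalRank_code hM] at h
  obtain ⟨k, N, B, D, d, hN, hmem⟩ := h
  choose W hW using fun i => exists_identity_seq (hmem i)
  refine ⟨((List.ofFn fun i => List.ofFn (N i), List.ofFn fun i => List.ofFn (B i),
    List.ofFn fun i => List.ofFn (D i)), (d, k), List.ofFn W),
    (valid_code_iff _).2 ⟨fun i hi => ?_, ?_⟩⟩
  · have hget : (List.ofFn W).getD i [] = W ⟨i, hi⟩ := by
      simp [List.getD_eq_getElem?_getD, hi]
    refine ⟨?_, fun j => ?_⟩
    · rw [hget]
      exact (hW ⟨i, hi⟩).1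
    · rw [hget, (hW ⟨i, hi⟩).2 j]
      exact entry_ofFn N (Fin.castAdd k ⟨i, hi⟩) j
  · simpa only [listMatrix_ofFn] using hN

theorem codeCycles_eq_rowsFrom {s k : ℕ} (A : List (List ℤ)) (v : Fin k → P.H2)
    (hv : ∀ i j, (v i : Fin P.n → ℤ) j = entry A (s + i) j) :
    P.codeCycles v = rowsFrom A s k P.n := by
  refine List.ext_getElem ?_ fun i h1 h2 => ?_
  · simp [codeCycles, rowsFrom]
  · refine List.ext_getElem ?_ fun j h3 h4 => ?_
    · simp [codeCycles, rowsFrom]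
    · simp [codeCycles, rowsFrom, hv]

/-- A valid certificate provides a basis of the group of spherical cycles and cycles that are mapped
to a basis of `H₂(G)`. -/
theorem exists_bases_of_valid {M : P.FormalMatrix} (hM : P.Admissible M) {c : Certificate}
    (hc : Valid (P.code M) c) :
    ∃ (u : Fin (sphericalRank (P.code M)) → P.H2) (w : Fin c.2.1.2 → P.H2),
      P.codeCycles u = rowsFrom c.1.1 0 (sphericalRank (P.code M)) P.n ∧
      P.codeCycles w = rowsFrom c.1.1 (sphericalRank (P.code M)) c.2.1.2 P.n ∧
      LinearIndependent ℤ u ∧ Submodule.span ℤ (Set.range u) = P.sigma ∧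
      LinearIndependent ℤ (fun i => P.hopf (w i)) ∧
      Submodule.span ℤ (Set.range fun i => P.hopf (w i)) = ⊤ := by
  obtain ⟨hseq, h⟩ := (valid_code_iff c).1 hc
  have hs := sphericalRank_code hM
  generalize sphericalRank (P.code M) = s at hseq h hs ⊢
  generalize hB : listMatrix P.n (s + c.2.1.2) c.1.2.1 = B at h
  have hspan : Submodule.span ℤ (Set.range fun i => h.vec (Fin.castAdd c.2.1.2 i)) = P.sigma := by
    refine span_eq_sigma hs.symm _ (fun i => ?_)
      -- The left inverse consists of the first `s` columns of `B`.
      (LinearMap.funLeft ℤ ℤ (Fin.castAdd c.2.1.2) ∘ₗ B.vecMulLinear) fun i => ?_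
    · convert signCount_mem_sphericalModule P (hseq i i.2).1 using 1
      exact funext fun j => (hseq i i.2).2 j
    · funext j
      have := congrFun (congrFun h.mul_eq_one (Fin.castAdd c.2.1.2 i)) (Fin.castAdd c.2.1.2 j)
      rw [Matrix.mul_apply_eq_vecMul] at this
      refine this.trans ?_
      rw [Matrix.one_apply, Pi.single_apply]
      exact if_congr (by rw [Fin.castAdd_inj, eq_comm]) rfl rfl
  refine ⟨fun i => h.vec (Fin.castAdd c.2.1.2 i), fun i => h.vec (Fin.natAdd s i),
    codeCycles_eq_rowsFrom _ _ fun i j => ?_, codeCycles_eq_rowsFrom _ _ fun i j => rfl,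
    h.linearIndependent.comp _ (Fin.castAdd_injective _ _), hspan, ?_⟩
  · rw [zero_add]
    rfl
  -- The first `s` basis vectors span `Σ_K`, the kernel of the Hopf map, so the others map to a
  -- basis of `H₂(G)`.
  · have := linearIndependent_and_span_of_ker P.hopf P.hopf_surjective (h.vec ∘ finSumFinEquiv)
      (h.linearIndependent.comp _ finSumFinEquiv.injective)
      (by rw [finSumFinEquiv.surjective.range_comp, h.span_eq_top])
      (by
        rw [P.ker_hopf, ← hspan]
        rfl)
    exact this

theorem exists_basis_groupH2_of_valid {M : P.FormalMatrix} (hM : P.Admissible M) {c : Certificate}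
    (hc : Valid (P.code M) c) : Nonempty (Module.Basis (Fin c.2.1.2) ℤ P.groupH2) := by
  obtain ⟨u, w, -, -, -, -, hli, hspan⟩ := exists_bases_of_valid hM hc
  exact ⟨Module.Basis.mk hli hspan.ge⟩

theorem finrank_groupH2_of_valid {M : P.FormalMatrix} (hM : P.Admissible M) {c : Certificate}
    (hc : Valid (P.code M) c) : Module.finrank ℤ P.groupH2 = c.2.1.2 := by
  obtain ⟨b⟩ := exists_basis_groupH2_of_valid hM hc
  rw [Module.finrank_eq_card_basis b, Fintype.card_fin]

theorem subsingleton_groupH2_iff_of_valid {M : P.FormalMatrix} (hM : P.Admissible M)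
    {c : Certificate} (hc : Valid (P.code M) c) : c.2.1.2 = 0 ↔ Subsingleton P.groupH2 := by
  obtain ⟨b⟩ := exists_basis_groupH2_of_valid hM hc
  rw [b.repr.toEquiv.subsingleton_congr]
  constructor
  · intro h
    rw [h]
    infer_instance
  · intro h
    by_contra h0
    have : Nonempty (Fin c.2.1.2) := Fin.pos_iff_nonempty.1 (Nat.pos_of_ne_zero h0)
    exact not_subsingleton (Fin c.2.1.2 →₀ ℤ) h

end FinPresentation

/-! ### The algorithms: one search for certificates, read in four ways -/

theorem proposition4p1 :
    -- `Σ_K` is effectively computable: an algorithm finds a basis of `Σ_K`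
    (∃ f : FinPresentation.Input →. List (List ℤ), Partrec f ∧
      ∀ (P : FinPresentation) (M : P.FormalMatrix), P.Admissible M →
        ∃ (k : ℕ) (v : Fin k → P.H2),
          P.codeCycles v ∈ f (P.code M) ∧
          LinearIndependent ℤ v ∧ Submodule.span ℤ (Set.range v) = P.sigma) ∧
    -- `H₂(G)` is effectively computable: an algorithm finds 2-cycles of `K` whose images under an
    -- epimorphism `H₂(K) → H₂(G)` with kernel `Σ_K` form a basis of `H₂(G)`
    (∃ f : FinPresentation.Input →. List (List ℤ), Partrec f ∧
      ∀ (P : FinPresentation) (M : P.FormalMatrix), P.Admissible M →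
        ∃ (φ : P.H2 →ₗ[ℤ] P.groupH2) (k : ℕ) (v : Fin k → P.H2),
          Function.Surjective φ ∧ LinearMap.ker φ = P.sigma ∧
          P.codeCycles v ∈ f (P.code M) ∧
          LinearIndependent ℤ (fun i => φ (v i)) ∧
          Submodule.span ℤ (Set.range fun i => φ (v i)) = ⊤) ∧
    -- `β₂(G)` is effectively computable
    (∃ f : FinPresentation.Input →. ℕ, Partrec f ∧
      ∀ (P : FinPresentation) (M : P.FormalMatrix), P.Admissible M →
        Module.finrank ℤ P.groupH2 ∈ f (P.code M)) ∧
    -- it is decidable whether `H₂(G) = 0`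
    (∃ f : FinPresentation.Input →. Bool, Partrec f ∧
      ∀ (P : FinPresentation) (M : P.FormalMatrix), P.Admissible M →
        ∃ b ∈ f (P.code M), (b = true ↔ Subsingleton P.groupH2)) ∧
    -- `Σ_K` is a direct summand of `H₂(K)`, and `H₂(G)` is torsion-free
    (∀ P : FinPresentation, P.HasCdTwo →
      (∃ T : Submodule ℤ P.H2, IsCompl P.sigma T) ∧
      ∀ (a : ℤ) (x : P.groupH2), a • x = 0 → a = 0 ∨ x = 0) := by
  have hn : Primrec fun p : FinPresentation.Input × FinPresentation.Certificate =>
      p.1.1.2.length := Primrec.list_length.comp (Primrec.snd.comp (Primrec.fst.comp Primrec.fst))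
  have hs : Primrec fun p : FinPresentation.Input × FinPresentation.Certificate =>
      FinPresentation.sphericalRank p.1 := FinPresentation.primrec_sphericalRank.comp Primrec.fst
  have hN : Primrec fun p : FinPresentation.Input × FinPresentation.Certificate => p.2.1.1 :=
    Primrec.fst.comp (Primrec.fst.comp Primrec.snd)
  have hk : Primrec fun p : FinPresentation.Input × FinPresentation.Certificate => p.2.2.1.2 :=
    Primrec.snd.comp (Primrec.fst.comp (Primrec.snd.comp Primrec.snd))
  have hlen : ∀ (P : FinPresentation) (M : P.FormalMatrix), (P.code M).1.2.length = P.n :=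
    fun P M => P.length_codeRel
  refine ⟨?_, ?_, ?_, ?_, fun P hP => ⟨P.exists_isCompl_sigma hP, P.groupH2_torsionFree hP⟩⟩
  -- The output is the first block of rows of the certificate, which is a basis of `Σ_K`; the second
  -- block serves for `H₂(G)`, and its length for `β₂(G)` and the vanishing test.
  · obtain ⟨f, hf, hfc⟩ := exists_partrec_search FinPresentation.primrecRel_valid
      (FinPresentation.primrec_rowsFrom hN (Primrec.const 0) hs hn).to₂
    refine ⟨f, hf, fun P M hM => ?_⟩
    obtain ⟨c, hc, hcf⟩ := hfc _ (FinPresentation.exists_valid hM)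
    obtain ⟨u, w, hu, -, hli, hspan, -⟩ := FinPresentation.exists_bases_of_valid hM hc
    rw [hlen, ← hu] at hcf
    exact ⟨_, u, hcf, hli, hspan⟩
  · obtain ⟨f, hf, hfc⟩ := exists_partrec_search FinPresentation.primrecRel_valid
      (FinPresentation.primrec_rowsFrom hN hs hk hn).to₂
    refine ⟨f, hf, fun P M hM => ?_⟩
    obtain ⟨c, hc, hcf⟩ := hfc _ (FinPresentation.exists_valid hM)
    obtain ⟨u, w, -, hw, -, -, hli, hspan⟩ := FinPresentation.exists_bases_of_valid hM hc
    rw [hlen, ← hw] at hcf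
    exact ⟨P.hopf, _, w, P.hopf_surjective, P.ker_hopf, hcf, hli, hspan⟩
  · obtain ⟨f, hf, hfc⟩ := exists_partrec_search FinPresentation.primrecRel_valid hk.to₂
    refine ⟨f, hf, fun P M hM => ?_⟩
    obtain ⟨c, hc, hcf⟩ := hfc _ (FinPresentation.exists_valid hM)
    rwa [FinPresentation.finrank_groupH2_of_valid hM hc]
  · obtain ⟨f, hf, hfc⟩ := exists_partrec_search FinPresentation.primrecRel_valid
      (Primrec.beq.comp hk (Primrec.const 0)).to₂
    refine ⟨f, hf, fun P M hM => ?_⟩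
    obtain ⟨c, hc, hcf⟩ := hfc _ (FinPresentation.exists_valid hM)
    refine ⟨_, hcf, ?_⟩
    rw [beq_iff_eq]
    exact FinPresentation.subsingleton_groupH2_iff_of_valid hM hc
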